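/- Let $H$ be a separable real Hilbert space and $N\ge 1$. For a metric space $\mathcal X$ let $\mathcal P_2(\mathcal X)$ be the set of Borel probability measures on $\mathcal X$ with finite second moment, with the Wasserstein-2 distance, and set $\mathcal P_2^0(H)=H$, $\mathcal P_2^{n+1}(H)=\mathcal P_2(\mathcal P_2^n(H))$. For $x,y\in H$ put $\mathrm{MC}(x,y)=\langle x,y\rangle$, and for $P,Q\in\mathcal P_2^{n+1}(H)$ put $$\mathrm{MC}(P,Q)=\sup_{\pi\in\mathrm{Cpl}(P,Q)}\int \mathrm{MC}(p,q)\,\pi(dp,dq),$$ where $\mathrm{Cpl}(P,Q)$ is the set of couplings of $P$ and $Q$. Call $\phi:\mathcal P_2^N(H)\to(-\infty,\infty]$ proper if it is not identically $\infty$; for proper $\phi$ let $\phi^{\mathrm{MC}}(Q)=\sup_{P\in\mathcal P_2^N(H)}\big(\mathrm{MC}(P,Q)-\phi(P)\big)$. A function is called $\mathrm{MC}$-convex if it equals $\psi^{\mathrm{MC}}$ for some proper $\psi:\mathcal P_2^N(H)\to(-\infty,\infty]$. Let $\lambda$ be the uniform distribution on $[0,1]^N$, let $\mathcal F_t$ be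 the $\sigma$-algebra generated by the first $t$ coordinates, and let $L_2^N(H)=L_2([0,1]^N,\lambda;H)$. The adapted law of $X\in L_2^N(H)$ is $$\mathcal L^{\mathrm{ad}}(X)=\mathcal L(\mathcal L(\cdots\mathcal L(X\mid\mathcal F_{N-1})\cdots\mid\mathcal F_1))\in\mathcal P_2^N(H),$$ and the adapted Lions lift of a function $\phi$ on $\mathcal P_2^N(H)$ is $\overline\phi(X)=\phi(\mathcal L^{\mathrm{ad}}(X))$, $X\in L_2^N(H)$. For $F$ on $L_2^N(H)$ let $F^*(Y)=\sup_{X\in L_2^N(H)}\big(\mathbb E[\langle X,Y\rangle]-F(X)\big)$. Call $F$ adapted-law invariant if $F(X)=F(Y)$ whenever $\mathcal L^{\mathrm{ad}}(X)=\mathcal L^{\mathrm{ad}}(Y)$. **Theorem.** Let $\phi:\mathcal P_2^N(H)\to(-\infty,\infty]$ be proper. Then $$\overline{\phi}^{\,*}=\overline{\phi^{\mathrm{MC}}}.$$ Moreover, $\overline\phi$ is lower semicontinuous and convex if and only if $\phi$ is $\mathrm{MC}$-convex. Finally, the convex conjugate of every adapted-law invariant function $F:L_2^N(H)\to(-\infty,\infty]$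 is adapted-law invariant. -/

import Mathlib

open MeasureTheory ProbabilityTheory
open scoped ENNReal

universe u

noncomputable section

namespace IteratedTransport

/-! ### Couplings, Wasserstein distance, maximal covariance (one step) -/

section OneStep

variable {X : Type u} [MeasurableSpace X]

/-- The set of couplings of `μ` and `ν`. -/
def Cpl (μ ν : Measure X) : Set (Measure (X × X)) :=
  {π | π.map Prod.fst = μ ∧ π.map Prod.snd = ν}

/-- The Wasserstein-2 distance over the distance function `d`. -/
def W2 (d : X → X → ℝ≥0∞) (μ ν : Measure X) : ℝ≥0∞ :=
  (⨅ π ∈ Cpl μ ν, ∫⁻ z, d z.1 z.2 ^ 2 ∂π) ^ (1 / 2 : ℝ)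

/-- Maximal transport value `sup_π ∫ c dπ` over all couplings `π` of `μ` and `ν`. -/
def maxCov (c : X → X → ℝ) (μ ν : Measure X) : ℝ :=
  ⨆ π : Cpl μ ν, ∫ z, c z.1 z.2 ∂(π : Measure (X × X))

/-- `μ` is a probability measure with finite second moment about the point `x₀`. -/
def MemP2 (d : X → X → ℝ≥0∞) (x₀ : X) (μ : Measure X) : Prop :=
  IsProbabilityMeasure μ ∧ ∫⁻ x, d x x₀ ^ 2 ∂μ < ∞

theorem lintegral_dirac_eq_zero {f : X → ℝ≥0∞} {a : X} (h : f a = 0) :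
    ∫⁻ x, f x ∂(Measure.dirac a) = 0 := by
  have key : ∫⁻ x, f x ∂(Measure.map (fun _ : Unit => a) (Measure.dirac ())) ≤
      ∫⁻ x, f ((fun _ : Unit => a) x) ∂(Measure.dirac ()) := lintegral_map_le _ _
  rw [Measure.map_dirac' measurable_const] at key
  simpa [h] using key

theorem memP2_dirac (d : X → X → ℝ≥0∞) (a : X) (h : d a a = 0) :
    MemP2 d a (Measure.dirac a) :=
  ⟨inferInstance, by rw [lintegral_dirac_eq_zero (by simp [h])]; simp⟩

theorem W2_dirac_self (d : X → X → ℝ≥0∞) (a : X) (h : d a a = 0) :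
    W2 d (Measure.dirac a) (Measure.dirac a) = 0 := by
  have hmem : Measure.dirac (a, a) ∈ Cpl (Measure.dirac a) (Measure.dirac a) :=
    ⟨Measure.map_dirac' measurable_fst _, Measure.map_dirac' measurable_snd _⟩
  have h0 : ⨅ π ∈ Cpl (Measure.dirac a) (Measure.dirac a), ∫⁻ z, d z.1 z.2 ^ 2 ∂π = 0 := by
    refine le_antisymm ((iInf₂_le _ hmem).trans (le_of_eq ?_)) zero_le
    exact lintegral_dirac_eq_zero (f := fun z : X × X => d z.1 z.2 ^ 2) (by simp [h])
  simp [W2, h0]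

end OneStep

/-! ### The iterated Wasserstein spaces -/

/-- A set with a σ-algebra, a distance function and a reference point: the data recorded at each
level of the tower of iterated Wasserstein spaces. It is only instantiated at the levels of that
tower. -/
structure Level : Type (u + 1) where
  carrier : Type u
  meas : MeasurableSpace carrier
  d : carrier → carrier → ℝ≥0∞
  point : carrier
  d_point : d point point = 0

/-- The Wasserstein space over a level: probability measures with finite second moment, with the
σ-algebra generated by the evaluations `μ ↦ μ B` (the Borel σ-algebra of the Wasserstein
distance, when the underlying space is Polish), the Wasserstein-2 distance, and the Dirac measure
at the reference point as reference point. -/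
def Level.next (L : Level.{u}) : Level.{u} :=
  letI := L.meas
  { carrier := {μ : Measure L.carrier // MemP2 L.d L.point μ}
    meas := inferInstance
    d := fun μ ν => W2 L.d μ.1 ν.1
    point := ⟨Measure.dirac L.point, memP2_dirac L.d L.point L.d_point⟩
    d_point := W2_dirac_self L.d L.point L.d_point }

variable (H : Type u) [NormedAddCommGroup H] [InnerProductSpace ℝ H]
  [MeasurableSpace H]

/-- The tower `H, P₂(H), P₂(P₂(H)), …`. -/
def level : ℕ → Level.{u}
  | 0 => ⟨H, inferInstance, fun x y => edist x y, 0, edist_self 0⟩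
  | n + 1 => (level n).next

/-- The iterated Wasserstein space `P₂ᴺ(H)`, with `P₂⁰(H) = H`. -/
abbrev P2 (N : ℕ) : Type u := (level H N).carrier

instance instMeasurableSpaceP2 (N : ℕ) : MeasurableSpace (P2 H N) := (level H N).meas

variable {H}

/-- An element of `P₂ᴺ⁺¹(H)` as a measure on `P₂ᴺ(H)`. -/
def P2.toMeasure {n : ℕ} (P : P2 H (n + 1)) : Measure (P2 H n) := P.1

open Classical in
/-- A measure on `P₂ⁿ(H)` as an element of `P₂ⁿ⁺¹(H)`, if it is a probability measure with finite
second moment (and an irrelevant default value otherwise). -/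
def P2.ofMeasure {n : ℕ} (μ : Measure (P2 H n)) : P2 H (n + 1) :=
  if h : MemP2 (level H n).d (level H n).point μ then ⟨μ, h⟩ else (level H (n + 1)).point

/-- The maximal covariance on `P₂ᴺ(H)`, starting from the inner product of `H`. -/
def MC : (N : ℕ) → P2 H N → P2 H N → ℝ
  | 0 => fun (x y : H) => inner ℝ x y
  | n + 1 => fun P Q => maxCov (MC n) P.toMeasure Q.toMeasure

/-- A function with values in `(-∞, ∞]` that is not identically `∞`. -/
def IsProper {α : Type*} (f : α → EReal) : Prop :=
  (∀ x, f x ≠ ⊥) ∧ ∃ x, f x ≠ ⊤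

/-- The transform `φ^MC (Q) = sup_P (MC(P, Q) - φ(P))`. -/
def mcTransform {N : ℕ} (φ : P2 H N → EReal) (Q : P2 H N) : EReal :=
  ⨆ P : P2 H N, ((MC N P Q : ℝ) : EReal) - φ P

/-- `ψ` is the MC-transform of some proper function. -/
def IsMCConvex {N : ℕ} (ψ : P2 H N → EReal) : Prop :=
  ∃ φ : P2 H N → EReal, IsProper φ ∧ ψ = mcTransform φ

/-! ### The filtered cube, adapted laws and adapted Lions lifts -/

/-- The cube `[0,1]ᴺ`; its `volume` is the uniform distribution. -/
abbrev Cube (N : ℕ) : Type := Fin N → unitInterval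

/-- The σ-algebra on `[0,1]ᴺ` generated by the first `t` coordinate projections. -/
abbrev coordSigma (N t : ℕ) : MeasurableSpace (Cube N) :=
  ⨆ (i : Fin N) (_ : (i : ℕ) < t), MeasurableSpace.comap (fun ω : Cube N => ω i) inferInstance

variable (H) in
/-- The Hilbert space `L₂([0,1]ᴺ; H)`. -/
abbrev L2 (N : ℕ) : Type u := Lp H 2 (volume : Measure (Cube N))

/-- The regular conditional law of `Y` given the first `t` coordinates. -/
def condLaw {N : ℕ} (t : ℕ) {k : ℕ} (Y : Cube N → P2 H k) : Cube N → P2 H (k + 1) :=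
  fun ω => P2.ofMeasure
    ((condExpKernel (volume : Measure (Cube N)) (coordSigma N t) ω).map Y)

/-- The iterated conditional law `𝓛(… 𝓛(X | F_{N-1}) … | F_{N-k})`. -/
def iterCondLaw {N : ℕ} (X : Cube N → H) : (k : ℕ) → Cube N → P2 H k
  | 0 => X
  | k + 1 => condLaw (N - (k + 1)) (iterCondLaw X k)

/-- The adapted law `𝓛(𝓛(… 𝓛(X | F_{N-1}) … | F_1))`. (For `N = 0` the cube is a point and the
value of `X` is returned.) -/
def adaptedLaw : {N : ℕ} → L2 H N → P2 H N
  | 0, X => (X : Cube 0 → H) default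
  | n + 1, X => P2.ofMeasure
      ((volume : Measure (Cube (n + 1))).map (iterCondLaw (X : Cube (n + 1) → H) n))

/-- The adapted Lions lift of a function on `P₂ᴺ(H)`. -/
def lionsLift {N : ℕ} (φ : P2 H N → EReal) : L2 H N → EReal :=
  fun X => φ (adaptedLaw X)

/-- Adapted-law invariance of a function on `L₂([0,1]ᴺ; H)`. -/
def AdaptedLawInvariant {N : ℕ} (F : L2 H N → EReal) : Prop :=
  ∀ X Y : L2 H N, adaptedLaw X = adaptedLaw Y → F X = F Y

end IteratedTransport

/-! ### Convex analysis for extended-real-valued functions -/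

/-- The convex conjugate `F*(y) = sup_x (⟨x, y⟩ - F(x))` on a real Hilbert space. -/
def convexConjugate {E : Type*} [NormedAddCommGroup E] [InnerProductSpace ℝ E]
    (F : E → EReal) (y : E) : EReal :=
  ⨆ x : E, ((inner ℝ x y : ℝ) : EReal) - F x

/-- Convexity of a function with values in `(-∞, ∞]`. -/
def IsConvexFun {E : Type*} [AddCommGroup E] [Module ℝ E] (F : E → EReal) : Prop :=
  ∀ x y : E, ∀ a b : ℝ, 0 < a → 0 < b → a + b = 1 →
    F (a • x + b • y) ≤ (a : EReal) * F x + (b : EReal) * F y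

end

open IteratedTransport

set_option linter.unusedSectionVars false

namespace IteratedTransport

/-! ### Second moments and the reference points of the tower -/

section Moments

/-! Everything rests on one duality: `MC` of the adapted laws of `X` and `Y` is the supremum of
`⟨X', Y⟩` over the rearrangements `X' = X ∘ T`, where `T` is a measure preserving map of the cube
that preserves all adapted laws (`HasTransportDuality`). Since every element of `P₂ᴺ(H)` is an
adapted law (`exists_measurable_section`), the supremum over `X` in the conjugate of a lift may be
taken first within one adapted law and then over all laws, which produces the MC-transform.
Invariance of conjugates follows by rearranging competitors, and the characterisation of
MC-convexity is Fenchel–Moreau in `L₂`, read through the lift.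

The duality is proved by induction on the dimension. In recursive form (`adLaw`), the adapted law of
`X` is the law of `t ↦ adLaw (slice X t)`, and `⟨X, Y⟩` is the integral of the inner products of
slices. The diagonal coupling of `t` with itself gives `⟨X, Y⟩ ≤ MC`. Conversely, any coupling of
the laws of slices comes from a coupling `γ` of two uniform variables. Up to a small error the
slices take countably many values, so `Y` enters through a countable label `j`. Each level set of
`j` still carries a uniform variable independent of `j`, so some map `S` gives `(S t, j t)` the law
of `(z.1, j z.2)` under `γ`. Gluing `S` to near-optimal transports of the remaining coordinates, one
for each pair of labels, gives `T`.

Conditional expectation kernels are replaced by slices in `adaptedLaw_eq_adLaw`. Measurability of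
`MC` is inherited from its continuity on `L₂ × L₂` along a measurable section, so no topology on the
iterated spaces is used. -/

theorem lintegral_coupling_dirac {X : Type u} [MeasurableSpace X] {μ : Measure X} {a : X}
    (ha : MeasurableSet {a}) {f : X → X → ℝ≥0∞} (hf : Measurable fun x => f x a)
    {π : Measure (X × X)} (hπ : π ∈ Cpl μ (Measure.dirac a)) :
    ∫⁻ z, f z.1 z.2 ∂π = ∫⁻ x, f x a ∂μ := by
  obtain ⟨h1, h2⟩ := hπ
  have hae : ∀ᵐ z ∂π, z.2 = a := by
    have h3 : π (Prod.snd ⁻¹' {a}ᶜ) = 0 := by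
      rw [← Measure.map_apply measurable_snd ha.compl, h2, Measure.dirac_apply' _ ha.compl]
      simp
    exact h3
  rw [← h1, lintegral_map hf measurable_fst]
  refine lintegral_congr_ae ?_
  filter_upwards [hae] with z hz
  rw [hz]

/-- All couplings with a Dirac mass have the same cost, and the product is one of them, so the
infimum disappears and the distance is a plain second moment. -/
theorem W2_dirac_sq {X : Type u} [MeasurableSpace X] {μ : Measure X} [IsProbabilityMeasure μ]
    {a : X} (ha : MeasurableSet {a}) {d : X → X → ℝ≥0∞} (hd : Measurable fun x => d x a) :
    W2 d μ (Measure.dirac a) ^ 2 = ∫⁻ x, d x a ^ 2 ∂μ := by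
  have hne : μ.prod (Measure.dirac a) ∈ Cpl μ (Measure.dirac a) := by
    constructor
    · exact Measure.map_fst_prod.trans (by simp)
    · exact Measure.map_snd_prod.trans (by simp)
  have h : ⨅ π ∈ Cpl μ (Measure.dirac a), ∫⁻ z, d z.1 z.2 ^ 2 ∂π = ∫⁻ x, d x a ^ 2 ∂μ := by
    have hc : ∀ π ∈ Cpl μ (Measure.dirac a), ∫⁻ z, d z.1 z.2 ^ 2 ∂π = ∫⁻ x, d x a ^ 2 ∂μ :=
      fun π hπ => lintegral_coupling_dirac (f := fun x y => d x y ^ 2) ha (hd.pow_const 2) hπ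
    refine le_antisymm ((iInf₂_le _ hne).trans (hc _ hne).le) ?_
    exact le_iInf₂ fun π hπ => (hc π hπ).ge
  rw [W2, h, ← ENNReal.rpow_natCast, ← ENNReal.rpow_mul]
  norm_num

end Moments

variable {H : Type u} [NormedAddCommGroup H] [InnerProductSpace ℝ H]
  [CompleteSpace H] [SecondCountableTopology H] [MeasurableSpace H] [BorelSpace H]

instance isProbabilityMeasure_toMeasure {n : ℕ} (P : P2 H (n + 1)) :
    IsProbabilityMeasure P.toMeasure := P.2.1

theorem P2.measurable_toMeasure {n : ℕ} :
    Measurable (P2.toMeasure : P2 H (n + 1) → Measure (P2 H n)) :=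
  measurable_subtype_coe

theorem P2.toMeasure_injective {n : ℕ} :
    Function.Injective (P2.toMeasure : P2 H (n + 1) → Measure (P2 H n)) :=
  Subtype.val_injective

/-- The σ-algebra is generated by evaluations, so points are not measurable for free. A Dirac mass
at a measurable point is the only probability measure giving that point mass one, which is an
evaluation condition. -/
theorem measurableSet_singleton_point (n : ℕ) :
    MeasurableSet ({(level H n).point} : Set (P2 H n)) := by
  induction n with
  | zero => exact measurableSet_singleton (0 : H)
  | succ n ih =>
    have h : ({(level H (n + 1)).point} : Set (P2 H (n + 1))) =
        {P | P.toMeasure {(level H n).point} = 1} := by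
      ext P
      simp only [Set.mem_singleton_iff, Set.mem_ofPred_eq]
      constructor
      · rintro rfl
        exact (Measure.dirac_apply' _ ih).trans (by simp)
      · intro hP
        apply P2.toMeasure_injective
        ext s hs
        change P.toMeasure s = Measure.dirac (level H n).point s
        rw [Measure.dirac_apply' _ hs]
        by_cases hmem : (level H n).point ∈ s
        · rw [Set.indicator_of_mem hmem]
          refine le_antisymm prob_le_one ?_
          exact hP.ge.trans (measure_mono (Set.singleton_subset_iff.2 hmem))
        · rw [Set.indicator_of_notMem hmem]
          refine measure_mono_null ?_ ((prob_compl_eq_zero_iff ih).2 hP)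
          exact Set.subset_compl_singleton_iff.2 hmem
    rw [h]
    exact (Measure.measurable_coe ih).comp P2.measurable_toMeasure (measurableSet_singleton 1)

/-- The squared Wasserstein distance to the reference point. -/
noncomputable def sqNorm (n : ℕ) (p : P2 H n) : ℝ≥0∞ := (level H n).d p (level H n).point ^ 2

theorem sqNorm_zero (x : P2 H 0) : sqNorm 0 x = ‖(show H from x)‖ₑ ^ 2 := by
  change edist (show H from x) 0 ^ 2 = _
  rw [edist_zero_right]

/-- The two claims feed each other: measurability at one level gives the moment formula one level
up, and that formula gives measurability there. -/
theorem measurable_dist_point (n : ℕ) :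
    Measurable (fun p : P2 H n => (level H n).d p (level H n).point) ∧
      ∀ P : P2 H (n + 1), sqNorm (n + 1) P = ∫⁻ p, sqNorm n p ∂P.toMeasure := by
  have key : ∀ n, Measurable (fun p : P2 H n => (level H n).d p (level H n).point) →
      ∀ P : P2 H (n + 1), sqNorm (n + 1) P = ∫⁻ p, sqNorm n p ∂P.toMeasure := by
    intro n hn P
    exact W2_dirac_sq (μ := P.toMeasure) (measurableSet_singleton_point n) hn
  have hmeas : ∀ n, Measurable (fun p : P2 H n => (level H n).d p (level H n).point) := by
    intro n
    induction n with
    | zero =>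
      have : Measurable fun x : H => edist x 0 := measurable_id.edist measurable_const
      exact this
    | succ n ih =>
      have h : (fun P : P2 H (n + 1) => (level H (n + 1)).d P (level H (n + 1)).point) =
          fun P => (∫⁻ p, sqNorm n p ∂P.toMeasure) ^ (1 / 2 : ℝ) := by
        funext P
        rw [← key n ih P, sqNorm, ← ENNReal.rpow_natCast, ← ENNReal.rpow_mul]
        norm_num
      rw [h]
      exact ((Measure.measurable_lintegral (ih.pow_const 2)).comp
        P2.measurable_toMeasure).pow_const _
  exact ⟨hmeas n, key n (hmeas n)⟩

theorem sqNorm_succ {n : ℕ} (P : P2 H (n + 1)) :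
    sqNorm (n + 1) P = ∫⁻ p, sqNorm n p ∂P.toMeasure := (measurable_dist_point n).2 P

theorem measurable_sqNorm (n : ℕ) : Measurable (sqNorm n : P2 H n → ℝ≥0∞) :=
  (measurable_dist_point n).1.pow_const 2

theorem memP2_iff {n : ℕ} (μ : Measure (P2 H n)) :
    MemP2 (level H n).d (level H n).point μ ↔
      IsProbabilityMeasure μ ∧ ∫⁻ p, sqNorm n p ∂μ < ∞ := Iff.rfl

theorem sqNorm_lt_top {n : ℕ} (p : P2 H n) : sqNorm n p < ∞ := by
  cases n with
  | zero => rw [sqNorm_zero]; exact ENNReal.pow_lt_top enorm_lt_top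
  | succ n => rw [sqNorm_succ]; exact p.2.2

theorem P2.toMeasure_ofMeasure {n : ℕ} {μ : Measure (P2 H n)} (hμ : IsProbabilityMeasure μ)
    (h : ∫⁻ p, sqNorm n p ∂μ < ∞) : (P2.ofMeasure μ).toMeasure = μ := by
  have h' : MemP2 (level H n).d (level H n).point μ := ⟨hμ, h⟩
  exact congrArg P2.toMeasure (dif_pos h')

theorem P2.measurable_ofMeasure {n : ℕ} :
    Measurable (P2.ofMeasure : Measure (P2 H n) → P2 H (n + 1)) := by
  classical
  have hset : MeasurableSet {μ : Measure (P2 H n) | MemP2 (level H n).d (level H n).point μ} := by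
    have h : {μ : Measure (P2 H n) | MemP2 (level H n).d (level H n).point μ} =
        {μ | μ Set.univ = 1} ∩ {μ | ∫⁻ p, sqNorm n p ∂μ < ∞} := by
      ext μ
      exact (memP2_iff μ).trans (and_congr isProbabilityMeasure_iff Iff.rfl)
    rw [h]
    exact (Measure.measurable_coe MeasurableSet.univ (measurableSet_singleton 1)).inter
      (measurableSet_lt (Measure.measurable_lintegral (measurable_sqNorm n)) measurable_const)
  refine Measurable.dite (s := {μ | MemP2 (level H n).d (level H n).point μ})
    (f := fun μ => (⟨μ.1, μ.2⟩ : P2 H (n + 1))) (g := fun _ => (level H (n + 1)).point) ?_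
    measurable_const hset
  exact Measurable.subtype_mk measurable_subtype_coe

/-! ### Adapted laws by recursion on the dimension of the cube -/

theorem measurable_cubeCons {n : ℕ} :
    Measurable fun z : unitInterval × Cube n => (Fin.cons z.1 z.2 : Cube (n + 1)) := by
  rw [measurable_pi_iff]
  intro i
  refine Fin.cases ?_ (fun j => ?_) i
  · simpa using measurable_fst
  · simpa [Function.comp_def] using (measurable_pi_apply j).comp measurable_snd

theorem measurePreserving_cubeCons (n : ℕ) :
    MeasurePreserving fun z : unitInterval × Cube n => (Fin.cons z.1 z.2 : Cube (n + 1)) := by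
  have h := (volume_preserving_piFinSuccAbove (fun _ : Fin (n + 1) => unitInterval) 0).symm
  convert h using 1
  funext z
  simp [MeasurableEquiv.piFinSuccAbove, Fin.insertNthEquiv]

/-- The adapted law of a function on the cube, by recursion on the first coordinate. -/
noncomputable def adLaw : {n : ℕ} → (Cube n → H) → P2 H n
  | 0, G => G default
  | _ + 1, G => P2.ofMeasure
      ((volume : Measure unitInterval).map fun t => adLaw fun ω => G (Fin.cons t ω))

theorem adLaw_succ {n : ℕ} (G : Cube (n + 1) → H) :
    adLaw G = P2.ofMeasure
      ((volume : Measure unitInterval).map fun t => adLaw fun ω => G (Fin.cons t ω)) := rfl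

theorem measurable_map_of_uncurry {α β γ : Type*} [MeasurableSpace α] [MeasurableSpace β]
    [MeasurableSpace γ] {μ : Measure β} [SFinite μ] {f : α → β → γ}
    (hf : Measurable (Function.uncurry f)) : Measurable fun a => μ.map (f a) := by
  refine Measure.measurable_of_measurable_coe _ fun s hs => ?_
  have h : ∀ a, μ.map (f a) s = μ (Prod.mk a ⁻¹' (Function.uncurry f ⁻¹' s)) := fun a =>
    Measure.map_apply hf.of_uncurry_left hs
  simp_rw [h]
  exact measurable_measure_prodMk_left (hf hs)

/-- The parameter space has to vary in the induction, because the first coordinate of the cube joins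
the parameters. -/
theorem measurable_adLaw {n : ℕ} {α : Type*} [MeasurableSpace α] {G : α → Cube n → H}
    (hG : Measurable (Function.uncurry G)) : Measurable fun a => adLaw (G a) := by
  induction n generalizing α with
  | zero => exact hG.of_uncurry_right (y := default)
  | succ n ih =>
    refine P2.measurable_ofMeasure.comp ?_
    refine measurable_map_of_uncurry (f := fun a t => adLaw fun ω => G a (Fin.cons t ω)) ?_
    refine ih (G := fun z : α × unitInterval => fun ω => G z.1 (Fin.cons z.2 ω)) ?_
    exact hG.comp (measurable_fst.fst.prodMk
      (measurable_cubeCons.comp (measurable_fst.snd.prodMk measurable_snd)))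

theorem ae_ae_of_ae_cube {n : ℕ} {p : Cube (n + 1) → Prop} (h : ∀ᵐ ω, p ω) :
    ∀ᵐ t : unitInterval, ∀ᵐ ω : Cube n, p (Fin.cons t ω) :=
  Measure.ae_ae_of_ae_prod ((measurePreserving_cubeCons n).quasiMeasurePreserving.ae h)

theorem adLaw_congr {n : ℕ} {G G' : Cube n → H} (h : G =ᵐ[volume] G') : adLaw G = adLaw G' := by
  induction n with
  | zero =>
    have h0 : ∀ᵐ ω : Cube 0, G default = G' default := by
      filter_upwards [h] with ω hω
      rwa [Subsingleton.elim default ω]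
    exact h0.exists.choose_spec
  | succ n ih =>
    rw [adLaw_succ, adLaw_succ]
    congr 1
    refine Measure.map_congr ?_
    filter_upwards [ae_ae_of_ae_cube h] with t ht
    exact ih ht

theorem lintegral_cube_succ {n : ℕ} {f : Cube (n + 1) → ℝ≥0∞} (hf : Measurable f) :
    ∫⁻ ω, f ω = ∫⁻ t : unitInterval, ∫⁻ ω : Cube n, f (Fin.cons t ω) := by
  rw [← (measurePreserving_cubeCons n).lintegral_comp hf, Measure.volume_eq_prod,
    lintegral_prod (fun z : unitInterval × Cube n => f (Fin.cons z.1 z.2))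
      (hf.comp measurable_cubeCons).aemeasurable]

/-- Both claims are proved at once: the moment identity shows that the law of the slices has finite
second moment, hence that `P2.ofMeasure` does not return its default value. Only almost every slice
is square integrable, which suffices. -/
theorem lintegral_sqNorm_slices {n : ℕ} {G : Cube (n + 1) → H} (hG : Measurable G)
    (h2 : ∫⁻ ω, ‖G ω‖ₑ ^ 2 < ∞)
    (ih : ∀ G : Cube n → H, Measurable G → ∫⁻ ω, ‖G ω‖ₑ ^ 2 < ∞ →
      sqNorm n (adLaw G) = ∫⁻ ω, ‖G ω‖ₑ ^ 2) :
    (adLaw G).toMeasure =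
      (volume : Measure unitInterval).map (fun t => adLaw fun ω => G (Fin.cons t ω)) ∧
    sqNorm (n + 1) (adLaw G) = ∫⁻ ω, ‖G ω‖ₑ ^ 2 := by
  have hm : Measurable fun ω => ‖G ω‖ₑ ^ 2 := hG.enorm.pow_const 2
  have hGc : Measurable (Function.uncurry fun (t : unitInterval) (ω : Cube n) =>
      G (Fin.cons t ω)) := hG.comp measurable_cubeCons
  have hmeas := measurable_adLaw hGc
  have hfin : ∀ᵐ t : unitInterval, ∫⁻ ω : Cube n, ‖G (Fin.cons t ω)‖ₑ ^ 2 < ∞ := by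
    refine ae_lt_top ?_ ?_
    · exact (hGc.enorm.pow_const 2).lintegral_prod_right'
    · rw [← lintegral_cube_succ hm]; exact h2.ne
  have heq : ∫⁻ p, sqNorm n p ∂((volume : Measure unitInterval).map
      fun t => adLaw fun ω => G (Fin.cons t ω)) = ∫⁻ ω, ‖G ω‖ₑ ^ 2 := by
    rw [lintegral_map (measurable_sqNorm n) hmeas, lintegral_cube_succ hm]
    refine lintegral_congr_ae ?_
    filter_upwards [hfin] with t ht
    exact ih _ hGc.of_uncurry_left ht
  have hlaw := P2.toMeasure_ofMeasure (Measure.isProbabilityMeasure_map hmeas.aemeasurable)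
    (heq ▸ h2)
  refine ⟨hlaw, ?_⟩
  rw [sqNorm_succ, adLaw_succ, hlaw, heq]

/-- For a square integrable function, the adapted law is not a default value. -/
theorem sqNorm_adLaw {n : ℕ} {G : Cube n → H} (hG : Measurable G)
    (h2 : ∫⁻ ω, ‖G ω‖ₑ ^ 2 < ∞) : sqNorm n (adLaw G) = ∫⁻ ω, ‖G ω‖ₑ ^ 2 := by
  induction n with
  | zero =>
    rw [sqNorm_zero]
    have : ∀ ω : Cube 0, ‖G ω‖ₑ ^ 2 = ‖G default‖ₑ ^ 2 := fun ω => by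
      rw [Subsingleton.elim ω default]
    simp_rw [this]
    simp
    rfl
  | succ n ih => exact (lintegral_sqNorm_slices hG h2 fun G hG h2 => ih hG h2).2

theorem toMeasure_adLaw {n : ℕ} {G : Cube (n + 1) → H} (hG : Measurable G)
    (h2 : ∫⁻ ω, ‖G ω‖ₑ ^ 2 < ∞) : (adLaw G).toMeasure =
      (volume : Measure unitInterval).map fun t => adLaw fun ω => G (Fin.cons t ω) :=
  (lintegral_sqNorm_slices hG h2 fun _ hG h2 => sqNorm_adLaw hG h2).1

end IteratedTransport

namespace IteratedTransport

/-! ### Conditioning on the first coordinates -/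

/-- Think of `s ω ω'` as keeping the `m`-information of `ω` and redrawing the rest from `ω'`. If
this preserves `μ`, redrawing is a version of the conditional law, and such versions agree almost
everywhere. -/
theorem condExpKernel_eq_map_of_resampling {Ω : Type*} {m mΩ : MeasurableSpace Ω}
    [StandardBorelSpace Ω] (hm : m ≤ mΩ) {μ : Measure Ω} [IsProbabilityMeasure μ]
    {s : Ω → Ω → Ω} (hs : @Measurable (Ω × Ω) Ω (m.prod mΩ) mΩ (Function.uncurry s))
    (hmap : (μ.prod μ).map (Function.uncurry s) = μ)
    (hinv : ∀ A, MeasurableSet[m] A → ∀ ω ω', s ω ω' ∈ A ↔ ω ∈ A) :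
    ∀ᵐ ω ∂μ, condExpKernel μ m ω = μ.map (s ω) := by
  have hs' : Measurable (Function.uncurry s) :=
    hs.mono (sup_le_sup (MeasurableSpace.comap_mono hm) le_rfl) le_rfl
  let κ : @Kernel Ω Ω m mΩ :=
    @Kernel.mk Ω Ω m mΩ (fun ω => μ.map (s ω))
      (@measurable_map_of_uncurry Ω Ω Ω m mΩ mΩ μ _ s hs)
  have hκ : @IsMarkovKernel Ω Ω m mΩ κ := by
    refine @IsMarkovKernel.mk Ω Ω m mΩ κ fun ω => ?_
    exact Measure.isProbabilityMeasure_map hs'.of_uncurry_left.aemeasurable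
  -- The left side is the law of `(ω, ω)`, with the first copy seen through `m`; equality is checked
  -- on rectangles.
  have hcomp : (μ.trim hm) ⊗ₘ condExpKernel μ m = (μ.trim hm) ⊗ₘ κ := by
    rw [compProd_trim_condExpKernel hm]
    have hdiag : @Measurable Ω (Ω × Ω) mΩ (m.prod mΩ) Function.diag :=
      by
      let _ : MeasurableSpace (Ω × Ω) := m.prod mΩ
      exact Measurable.prodMk (measurable_id'' hm) measurable_id
    have hfin : IsFiniteMeasure (@Measure.map Ω (Ω × Ω) mΩ (m.prod mΩ) Function.diag μ) :=
      inferInstance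
    refine @Measure.ext_prod Ω Ω m mΩ _ _ hfin fun {A B} hA hB => ?_
    rw [Measure.compProd_apply_prod hA hB, Measure.map_apply hdiag (hA.prod hB),
      restrict_trim hm _ hA, lintegral_trim hm (Kernel.measurable_coe κ hB)]
    have h1 : ∀ ω, κ ω B = μ (Prod.mk ω ⁻¹' (Function.uncurry s ⁻¹' B)) := fun ω =>
      Measure.map_apply hs'.of_uncurry_left hB
    have hA' := hm _ hA
    calc μ (Function.diag ⁻¹' A ×ˢ B) = μ (A ∩ B) := rfl
      _ = (μ.prod μ) (Function.uncurry s ⁻¹' (A ∩ B)) := by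
        conv_lhs => rw [← hmap]
        rw [Measure.map_apply hs' (hA'.inter hB)]
      _ = ∫⁻ ω in A, κ ω B ∂μ := by
        rw [Measure.prod_apply (hs' (hA'.inter hB)), ← lintegral_indicator hA']
        refine lintegral_congr fun ω => ?_
        by_cases hω : ω ∈ A
        · rw [Set.indicator_of_mem hω, h1]
          congr 1
          ext ω'
          simp [Function.uncurry, hinv A hA, hω]
        · rw [Set.indicator_of_notMem hω]
          convert measure_empty (μ := μ)
          ext ω'
          simp [Function.uncurry, hinv A hA, hω]
  exact ae_of_ae_trim hm (Kernel.ae_eq_of_compProd_eq hcomp)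

/-- The point with the first `t` coordinates of `ω` and the remaining coordinates of `ω'`. -/
def splice {N : ℕ} (t : ℕ) (ω ω' : Cube N) : Cube N := fun i => if (i : ℕ) < t then ω i else ω' i

theorem coordSigma_le (N t : ℕ) : coordSigma N t ≤ MeasurableSpace.pi :=
  iSup₂_le fun i _ => (measurable_pi_apply i).comap_le

theorem measurable_splice {N : ℕ} (t : ℕ) :
    @Measurable (Cube N × Cube N) (Cube N) ((coordSigma N t).prod MeasurableSpace.pi)
      MeasurableSpace.pi (Function.uncurry (splice t)) := by
  refine @measurable_pi_lambda _ _ _ ((coordSigma N t).prod MeasurableSpace.pi) _ _ fun i => ?_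
  by_cases hi : (i : ℕ) < t
  · have h : (fun z : Cube N × Cube N => Function.uncurry (splice t) z i) =
        (fun ω : Cube N => ω i) ∘ Prod.fst := by
      funext z; simp [Function.uncurry, splice, hi]
    rw [h]
    have h1 : @Measurable (Cube N) unitInterval (coordSigma N t) _ fun ω => ω i := by
      rw [measurable_iff_comap_le]
      exact le_iSup₂_of_le i hi le_rfl
    exact h1.comp (@measurable_fst _ _ (coordSigma N t) _)
  · have h : (fun z : Cube N × Cube N => Function.uncurry (splice t) z i) =
        (fun ω : Cube N => ω i) ∘ Prod.snd := by
      funext z; simp [Function.uncurry, splice, hi]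
    rw [h]
    exact (measurable_pi_apply i).comp (@measurable_snd _ _ (coordSigma N t) _)

theorem map_splice {N : ℕ} (t : ℕ) :
    ((volume : Measure (Cube N)).prod volume).map (Function.uncurry (splice t)) = volume := by
  have hm : Measurable (Function.uncurry (splice (N := N) t)) :=
    (measurable_splice t).mono
      (sup_le_sup (MeasurableSpace.comap_mono (coordSigma_le N t)) le_rfl) le_rfl
  refine (Measure.pi_eq fun s hs => ?_).symm
  rw [Measure.map_apply hm (MeasurableSet.univ_pi hs)]
  have h : Function.uncurry (splice t) ⁻¹' (Set.univ.pi s) =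
      (Set.univ.pi fun i : Fin N => if (i : ℕ) < t then s i else Set.univ) ×ˢ
      (Set.univ.pi fun i : Fin N => if (i : ℕ) < t then Set.univ else s i) := by
    ext z
    simp only [Function.uncurry, splice, Set.mem_preimage, Set.mem_pi, Set.mem_univ, true_imp_iff,
      Set.mem_prod, ← forall_and]
    refine forall_congr' fun i => ?_
    by_cases hi : (i : ℕ) < t <;> simp [hi]
  rw [h, Measure.prod_prod, volume_pi, Measure.pi_pi, Measure.pi_pi, ← Finset.prod_mul_distrib]
  refine Finset.prod_congr rfl fun i _ => ?_
  by_cases hi : (i : ℕ) < t <;> simp [hi]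

theorem splice_mem_iff {N t : ℕ} {A : Set (Cube N)} (hA : MeasurableSet[coordSigma N t] A)
    (ω ω' : Cube N) : splice t ω ω' ∈ A ↔ ω ∈ A := by
  let r : Cube N → {i : Fin N // (i : ℕ) < t} → unitInterval := fun ω i => ω i
  -- Only dependence on the first `t` coordinates matters here, so the target of `r` may carry the
  -- full power set.
  have hle : coordSigma N t ≤ MeasurableSpace.comap r ⊤ := by
    refine iSup₂_le fun i hi => ?_
    rintro _ ⟨B, -, rfl⟩
    exact ⟨{f | f ⟨i, hi⟩ ∈ B}, trivial, rfl⟩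
  obtain ⟨B, -, rfl⟩ := hle _ hA
  have h : r (splice t ω ω') = r ω := by
    funext i
    simp [r, splice, i.2]
  simp [h]

theorem condExpKernel_coordSigma (N t : ℕ) :
    ∀ᵐ ω : Cube N, condExpKernel (volume : Measure (Cube N)) (coordSigma N t) ω =
      volume.map (splice t ω) :=
  condExpKernel_eq_map_of_resampling (coordSigma_le N t) (measurable_splice t) (map_splice t)
    fun _ hA => splice_mem_iff hA

variable {H : Type u} [NormedAddCommGroup H] [InnerProductSpace ℝ H]
  [CompleteSpace H] [SecondCountableTopology H] [MeasurableSpace H] [BorelSpace H]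

/-- The point of `[0,1]ᴺ` whose last `k` coordinates are those of `ω'` and whose first `N - k`
coordinates are those of `ω`. -/
def replaceTail {N : ℕ} (k : ℕ) (ω : Cube N) (ω' : Cube k) : Cube N := fun i =>
  if h : (i : ℕ) < N - k then ω i else ω' ⟨i - (N - k), by omega⟩

theorem measurable_replaceTail {N : ℕ} (k : ℕ) :
    Measurable (Function.uncurry (replaceTail (N := N) k)) := by
  rw [measurable_pi_iff]
  intro i
  by_cases hi : (i : ℕ) < N - k
  · simpa [Function.uncurry, replaceTail, hi, Function.comp_def] using
      (measurable_pi_apply i).comp measurable_fst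
  · simpa [Function.uncurry, replaceTail, hi, Function.comp_def] using
      (measurable_pi_apply _).comp measurable_snd

/-- Of the redrawn coordinates only the one of index `N - (k + 1)` survives; it becomes the head of
the longer tail. -/
theorem replaceTail_splice {N k : ℕ} (hk : k + 1 ≤ N) (ω ω' : Cube N) (η : Cube k) :
    replaceTail k (splice (N - (k + 1)) ω ω') η =
      replaceTail (k + 1) ω (Fin.cons (ω' ⟨N - (k + 1), by omega⟩) η) := by
  funext i
  simp only [replaceTail, splice]
  rcases lt_trichotomy (i : ℕ) (N - (k + 1)) with h | h | h
  · rw [dif_pos (by omega), if_pos h, dif_pos h]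
  · rw [dif_pos (by omega), if_neg (by omega), dif_neg (by omega)]
    have h1 : (⟨(i : ℕ) - (N - (k + 1)), by omega⟩ : Fin (k + 1)) = 0 := by
      ext; simp [h]
    have h2 : (⟨N - (k + 1), by omega⟩ : Fin N) = i := by ext; simp [h]
    rw [h1, Fin.cons_zero, h2]
  · rw [dif_neg (by omega), dif_neg (by omega)]
    have h1 : (⟨(i : ℕ) - (N - (k + 1)), by omega⟩ : Fin (k + 1)) =
        Fin.succ ⟨(i : ℕ) - (N - k), by omega⟩ := by
      ext; simp; omega
    rw [h1, Fin.cons_succ]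

/-- Conditioning redraws the coordinates from `N - (k + 1)` on. The last `k` of them are already
integrated out in the inner adapted law, so a single new uniform coordinate remains, as in the
recursion of `adLaw`. -/
theorem iterCondLaw_ae_eq {N : ℕ} {X : Cube N → H} (hX : Measurable X) {k : ℕ} (hk : k ≤ N) :
    iterCondLaw X k =ᵐ[volume] fun ω => adLaw fun η => X (replaceTail k ω η) := by
  induction k with
  | zero =>
    refine Filter.Eventually.of_forall fun ω => ?_
    change X ω = X (replaceTail 0 ω default)
    congr 1
    funext i
    simp [replaceTail]
  | succ k ih =>
    have ih' := ih (by omega)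
    have hmap := map_splice (N := N) (N - (k + 1))
    have hs : Measurable (Function.uncurry (splice (N := N) (N - (k + 1)))) :=
      (measurable_splice _).mono
        (sup_le_sup (MeasurableSpace.comap_mono (coordSigma_le N _)) le_rfl) le_rfl
    -- Splicing preserves the product measure, so by Fubini a null set stays null for almost every
    -- conditional law.
    have hae : ∀ᵐ ω : Cube N, iterCondLaw X k =ᵐ[volume.map (splice (N - (k + 1)) ω)]
        fun ζ => adLaw fun η => X (replaceTail k ζ η) := by
      obtain ⟨Z, hZ, hZm, hZ0⟩ := exists_measurable_superset_of_null (ae_iff.1 ih')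
      rw [← hmap, Measure.map_apply hs hZm] at hZ0
      filter_upwards [Measure.measure_ae_null_of_prod_null hZ0] with ω hω
      refine measure_mono_null hZ ?_
      rw [Measure.map_apply hs.of_uncurry_left hZm]
      exact hω
    filter_upwards [condExpKernel_coordSigma N (N - (k + 1)), hae] with ω hω hω'
    rw [iterCondLaw, condLaw, hω, adLaw_succ]
    congr 1
    have hg : Measurable fun ζ : Cube N => adLaw fun η => X (replaceTail k ζ η) :=
      measurable_adLaw (hX.comp (measurable_replaceTail k))
    have hsω : Measurable (splice (N - (k + 1)) ω) := hs.of_uncurry_left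
    rw [Measure.map_congr hω', Measure.map_map hg hsω]
    have hev := measurePreserving_eval (fun _ : Fin N => (volume : Measure unitInterval))
      ⟨N - (k + 1), by omega⟩
    have hg' : Measurable fun t : unitInterval =>
        adLaw fun η : Cube k => X (replaceTail (k + 1) ω (Fin.cons t η)) := by
      refine measurable_adLaw (G := fun t η => X (replaceTail (k + 1) ω (Fin.cons t η))) ?_
      exact hX.comp ((measurable_replaceTail (k + 1)).of_uncurry_left.comp measurable_cubeCons)
    conv_rhs => rw [← hev.map_eq, Measure.map_map hg' hev.measurable]
    congr 1
    funext ω'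
    simp only [Function.comp_apply, Function.eval, replaceTail_splice hk]

theorem adaptedLaw_eq_adLaw {N : ℕ} (X : L2 H N) : adaptedLaw X = adLaw (X : Cube N → H) := by
  cases N with
  | zero => rfl
  | succ n =>
    have hX : Measurable (X : Cube (n + 1) → H) := (Lp.stronglyMeasurable X).measurable
    rw [adaptedLaw, adLaw_succ, Measure.map_congr (iterCondLaw_ae_eq hX (Nat.le_succ n))]
    congr 1
    have hg' : Measurable fun t : unitInterval =>
        adLaw fun η : Cube n => X (Fin.cons t η) :=
      measurable_adLaw (G := fun t η => X (Fin.cons t η)) (hX.comp measurable_cubeCons)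
    have hev := measurePreserving_eval (fun _ : Fin (n + 1) => (volume : Measure unitInterval)) 0
    conv_rhs => rw [← hev.map_eq, Measure.map_map hg' hev.measurable]
    congr 1
    funext ω
    simp only [Function.comp_apply, Function.eval]
    congr 1
    funext η
    congr 1
    funext i
    refine Fin.cases ?_ (fun j => ?_) i
    · simp [replaceTail]
    · simp [replaceTail]

end IteratedTransport

namespace IteratedTransport

variable {H : Type u} [NormedAddCommGroup H] [InnerProductSpace ℝ H]
  [CompleteSpace H] [SecondCountableTopology H] [MeasurableSpace H] [BorelSpace H]

/-! ### Slices of square integrable functions -/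

noncomputable instance instMeasurableSpaceL2 (n : ℕ) : MeasurableSpace (L2 H n) := borel _

instance instBorelSpaceL2 (n : ℕ) : BorelSpace (L2 H n) := ⟨rfl⟩

instance instSecondCountableTopologyL2 (n : ℕ) : SecondCountableTopology (L2 H n) :=
  haveI : Fact ((2 : ℝ≥0∞) ≠ ∞) := ⟨by norm_num⟩
  haveI := isSeparable_of_sigmaFinite (volume : Measure (Cube n))
  Lp.SecondCountableTopology

theorem enorm_sq_eq_lintegral {n : ℕ} (X : L2 H n) : ‖X‖ₑ ^ 2 = ∫⁻ ω, ‖X ω‖ₑ ^ 2 := by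
  rw [Lp.enorm_def, eLpNorm_eq_lintegral_rpow_enorm_toReal (by norm_num) (by norm_num),
    ← ENNReal.rpow_natCast, ← ENNReal.rpow_mul]
  norm_num

theorem memLp_two_iff {n : ℕ} {G : Cube n → H} (hG : Measurable G) :
    MemLp G 2 volume ↔ ∫⁻ ω, ‖G ω‖ₑ ^ 2 < ∞ := by
  rw [MemLp, eLpNorm_lt_top_iff_lintegral_rpow_enorm_lt_top (by norm_num) (by norm_num)]
  simp [hG.aestronglyMeasurable]

/-- In a second countable space every open set is a countable union of balls. -/
theorem measurable_of_measurable_edist {α E : Type*} [MeasurableSpace α] [PseudoEMetricSpace E]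
    [SecondCountableTopology E] [MeasurableSpace E] [BorelSpace E] {f : α → E}
    (hf : ∀ e, Measurable fun a => edist (f a) e) : Measurable f := by
  refine measurable_of_isOpen fun U hU => ?_
  choose! r hr hsub using fun x => EMetric.isOpen_iff.1 hU x
  have hU' : U = ⋃ x : U, Metric.eball (x : E) (r x) := by
    ext y
    simp only [Set.mem_iUnion]
    exact ⟨fun hy => ⟨⟨y, hy⟩, Metric.mem_eball_self (hr y hy)⟩,
      fun ⟨x, hx⟩ => hsub x x.2 hx⟩
  obtain ⟨T, hT, hTU⟩ := TopologicalSpace.isOpen_iUnion_countable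
    (fun x : U => Metric.eball (x : E) (r x)) fun _ => Metric.isOpen_eball
  rw [hU', ← hTU, Set.preimage_iUnion₂]
  exact MeasurableSet.biUnion hT fun x _ => measurableSet_lt (hf x) measurable_const

theorem measurable_of_ae_eq_uncurry {n : ℕ} {α : Type*} [MeasurableSpace α] {Φ : α → L2 H n}
    {G : α → Cube n → H} (hG : Measurable (Function.uncurry G)) (h : ∀ a, Φ a =ᵐ[volume] G a) :
    Measurable Φ := by
  refine measurable_of_measurable_edist fun e => ?_
  have he : Measurable (e : Cube n → H) := (Lp.stronglyMeasurable e).measurable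
  have h1 : ∀ a, edist (Φ a) e = (∫⁻ ω, ‖G a ω - e ω‖ₑ ^ 2) ^ (1 / 2 : ℝ) := by
    intro a
    have h2 : ‖Φ a - e‖ₑ ^ 2 = ∫⁻ ω, ‖G a ω - e ω‖ₑ ^ 2 := by
      rw [enorm_sq_eq_lintegral]
      refine lintegral_congr_ae ?_
      filter_upwards [h a, Lp.coeFn_sub (Φ a) e] with ω h1 h2
      rw [h2, Pi.sub_apply, h1]
    rw [← h2, edist_eq_enorm_sub, ← ENNReal.rpow_natCast, ← ENNReal.rpow_mul]
    norm_num
  simp_rw [h1]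
  refine Measurable.pow_const ?_ _
  exact Measurable.lintegral_prod_right'
    (f := fun z : α × Cube n => ‖G z.1 z.2 - e z.2‖ₑ ^ 2)
    ((hG.sub (he.comp measurable_snd)).enorm.pow_const 2)

/-- Take the first element of a dense sequence within `ε`. The countable label `r` serves to build
measurable representatives and, later, to discretise slices. -/
theorem exists_measurable_net {E : Type*} [PseudoEMetricSpace E] [SecondCountableTopology E]
    [MeasurableSpace E] [BorelSpace E] [Nonempty E] {ε : ℝ≥0∞} (hε : 0 < ε) :
    ∃ (e : ℕ → E) (r : E → ℕ), Measurable r ∧ ∀ x, edist x (e (r x)) < ε := by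
  classical
  let e : ℕ → E := TopologicalSpace.denseSeq E
  have hex : ∀ x : E, ∃ i, edist x (e i) < ε := by
    intro x
    obtain ⟨i, hi⟩ := (TopologicalSpace.denseRange_denseSeq E).exists_mem_open
      (Metric.isOpen_eball (x := x) (ε := ε)) ⟨x, Metric.mem_eball_self hε⟩
    exact ⟨i, by rw [edist_comm]; exact hi⟩
  exact ⟨e, fun x => Nat.find (hex x), measurable_find hex fun i =>
    measurableSet_lt (measurable_id.edist measurable_const) measurable_const,
    fun x => Nat.find_spec (hex x)⟩

/-- There is a jointly measurable choice of representatives. -/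
theorem exists_measurable_representative (n : ℕ) : ∃ ev : L2 H n → Cube n → H,
    Measurable (Function.uncurry ev) ∧ ∀ X, ev X =ᵐ[volume] X := by
  -- Geometric radii make the approximants converge almost everywhere, not only in `L₂`.
  choose e idx hidx hdist using fun k : ℕ => exists_measurable_net (E := L2 H n)
    (ε := (2⁻¹ : ℝ≥0∞) ^ (k + 1)) (ENNReal.pow_pos (by norm_num) _)
  let f : ℕ → L2 H n → Cube n → H := fun k X => e k (idx k X)
  have hf : ∀ k, Measurable (Function.uncurry (f k)) := by
    intro k
    have h1 : Measurable fun z : ℕ × Cube n => (e k z.1 : Cube n → H) z.2 :=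
      measurable_from_prod_countable_right fun i => (Lp.stronglyMeasurable (e k i)).measurable
    exact h1.comp ((hidx k).comp measurable_fst |>.prodMk measurable_snd)
  refine ⟨fun X ω => Filter.limUnder Filter.atTop fun k => f k X ω, ?_, fun X => ?_⟩
  · exact (StronglyMeasurable.limUnder (f := fun k => Function.uncurry (f k))
      fun k => (hf k).stronglyMeasurable).measurable
  · have hB : ∑' N : ℕ, (2⁻¹ : ℝ≥0∞) ^ N ≠ ∞ := by
      rw [ENNReal.tsum_geometric_two]; norm_num
    have hcau : ∀ N k l : ℕ, N ≤ k → N ≤ l →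
        eLpNorm (f k X - f l X) 2 volume < (2⁻¹ : ℝ≥0∞) ^ N := by
      intro N k l hk hl
      rw [← Lp.edist_def]
      have hmono : ∀ j, N ≤ j → edist X (e j (idx j X)) < (2⁻¹ : ℝ≥0∞) ^ (N + 1) := fun j hj =>
        (hdist j X).trans_le (pow_le_pow_of_le_one zero_le (by norm_num) (by omega))
      calc edist (e k (idx k X)) (e l (idx l X))
          ≤ edist X (e k (idx k X)) + edist X (e l (idx l X)) := edist_triangle_left _ _ _
        _ < (2⁻¹ : ℝ≥0∞) ^ (N + 1) + (2⁻¹ : ℝ≥0∞) ^ (N + 1) :=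
          ENNReal.add_lt_add (hmono k hk) (hmono l hl)
        _ = (2⁻¹ : ℝ≥0∞) ^ N := by
          rw [pow_succ, ← mul_add, ENNReal.inv_two_add_inv_two, mul_one]
    have hsm : ∀ k, AEStronglyMeasurable (f k X) volume := fun k =>
      (Lp.stronglyMeasurable _).aestronglyMeasurable
    have hlim := Lp.ae_tendsto_of_cauchy_eLpNorm hsm (by norm_num) hB hcau
    -- The pointwise limit is identified with `X` along an almost surely convergent subsequence
    -- supplied by `L₂` convergence.
    have hLp : Filter.Tendsto (fun k => eLpNorm (f k X - (X : Cube n → H)) 2 volume) Filter.atTop (nhds 0) := by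
      have h0 : Filter.Tendsto (fun k : ℕ => (2⁻¹ : ℝ≥0∞) ^ (k + 1)) Filter.atTop (nhds 0) :=
        (Filter.tendsto_add_atTop_iff_nat 1).2
          (ENNReal.tendsto_pow_atTop_nhds_zero_of_lt_one (by norm_num))
      refine tendsto_of_tendsto_of_tendsto_of_le_of_le tendsto_const_nhds h0 (fun _ => zero_le)
        fun k => ?_
      change eLpNorm (f k X - (X : Cube n → H)) 2 volume ≤ _
      rw [← Lp.edist_def, edist_comm]
      exact (hdist k X).le
    obtain ⟨ns, hns, hsub⟩ := (tendstoInMeasure_of_tendsto_eLpNorm (by norm_num) hsm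
      (Lp.stronglyMeasurable X).aestronglyMeasurable hLp).exists_seq_tendsto_ae
    filter_upwards [hlim, hsub] with ω ⟨l, hl⟩ h2
    rw [tendsto_nhds_unique h2 (hl.comp hns.tendsto_atTop)]
    exact hl.limUnder_eq

end IteratedTransport

/-! ### Slicing along the first coordinate and realising every element as an adapted law -/

namespace IteratedTransport

variable {H : Type u} [NormedAddCommGroup H] [InnerProductSpace ℝ H]
  [CompleteSpace H] [SecondCountableTopology H] [MeasurableSpace H] [BorelSpace H]

open Classical in
/-- The class of a function in `L₂`, and zero if the function is not square integrable. -/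
noncomputable def toL2 {n : ℕ} (G : Cube n → H) : L2 H n :=
  if h : MemLp G 2 volume then h.toLp G else 0

theorem toL2_ae_eq {n : ℕ} {G : Cube n → H} (hG : Measurable G)
    (h2 : ∫⁻ ω, ‖G ω‖ₑ ^ 2 < ∞) : toL2 G =ᵐ[volume] G := by
  have h := (memLp_two_iff hG).2 h2
  rw [toL2, dif_pos h]
  exact h.coeFn_toLp

theorem measurable_toL2 {n : ℕ} {α : Type*} [MeasurableSpace α] {G : α → Cube n → H}
    (hG : Measurable (Function.uncurry G)) : Measurable fun a => toL2 (G a) := by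
  classical
  have hS : MeasurableSet {a | ∫⁻ ω, ‖G a ω‖ₑ ^ 2 < ∞} :=
    measurableSet_lt ((hG.enorm.pow_const 2).lintegral_prod_right') measurable_const
  refine measurable_of_ae_eq_uncurry
    (G := fun a ω => if a ∈ {a | ∫⁻ ω, ‖G a ω‖ₑ ^ 2 < ∞} then G a ω else 0) ?_ fun a => ?_
  · exact Measurable.ite (measurable_fst hS) hG measurable_const
  · by_cases ha : a ∈ {a | ∫⁻ ω, ‖G a ω‖ₑ ^ 2 < ∞}
    · simp only [ha, if_true]
      exact toL2_ae_eq hG.of_uncurry_left ha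
    · simp only [ha, if_false]
      rw [toL2, dif_neg fun h => ha ((memLp_two_iff hG.of_uncurry_left).1 h)]
      exact Lp.coeFn_zero _ _ _

theorem measurable_coe_L2 {n : ℕ} (X : L2 H n) : Measurable (X : Cube n → H) :=
  (Lp.stronglyMeasurable X).measurable

theorem lintegral_enorm_sq_lt_top {n : ℕ} (X : L2 H n) : ∫⁻ ω, ‖X ω‖ₑ ^ 2 < ∞ := by
  rw [← enorm_sq_eq_lintegral]
  exact ENNReal.pow_lt_top enorm_lt_top

theorem sqNorm_adLaw_L2 {n : ℕ} (X : L2 H n) : sqNorm n (adLaw X) = ‖X‖ₑ ^ 2 := by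
  rw [enorm_sq_eq_lintegral, sqNorm_adLaw (measurable_coe_L2 X) (lintegral_enorm_sq_lt_top X)]

theorem measurable_adLaw_L2 (n : ℕ) : Measurable fun X : L2 H n => adLaw X := by
  obtain ⟨ev, hev, hae⟩ := exists_measurable_representative (H := H) n
  have h : (fun X : L2 H n => adLaw X) = fun X => adLaw (ev X) :=
    funext fun X => (adLaw_congr (hae X)).symm
  rw [h]
  exact measurable_adLaw hev

/-- The slice of a square integrable function at the value `t` of the first coordinate. -/
noncomputable def slice {n : ℕ} (X : L2 H (n + 1)) (t : unitInterval) : L2 H n :=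
  toL2 fun ω => X (Fin.cons t ω)

theorem measurable_slice_uncurry {n : ℕ} (X : L2 H (n + 1)) : Measurable
    (Function.uncurry fun (t : unitInterval) (ω : Cube n) => X (Fin.cons t ω)) :=
  (measurable_coe_L2 X).comp measurable_cubeCons

theorem measurable_slice {n : ℕ} (X : L2 H (n + 1)) : Measurable (slice X) :=
  measurable_toL2 (measurable_slice_uncurry X)

theorem slice_ae_eq {n : ℕ} (X : L2 H (n + 1)) :
    ∀ᵐ t, slice X t =ᵐ[volume] fun ω => X (Fin.cons t ω) := by
  have hm := measurable_slice_uncurry X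
  have hfin : ∀ᵐ t : unitInterval, ∫⁻ ω : Cube n, ‖X (Fin.cons t ω)‖ₑ ^ 2 < ∞ := by
    refine ae_lt_top ((hm.enorm.pow_const 2).lintegral_prod_right') ?_
    have h := lintegral_cube_succ (n := n) ((measurable_coe_L2 X).enorm.pow_const 2)
    exact (h ▸ lintegral_enorm_sq_lt_top X).ne
  filter_upwards [hfin] with t ht
  exact toL2_ae_eq hm.of_uncurry_left ht

theorem lintegral_enorm_sq_slice {n : ℕ} (X : L2 H (n + 1)) :
    ∫⁻ t, ‖slice X t‖ₑ ^ 2 = ‖X‖ₑ ^ 2 := by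
  rw [enorm_sq_eq_lintegral, lintegral_cube_succ ((measurable_coe_L2 X).enorm.pow_const 2)]
  refine lintegral_congr_ae ?_
  filter_upwards [slice_ae_eq X] with t ht
  rw [enorm_sq_eq_lintegral]
  refine lintegral_congr_ae ?_
  filter_upwards [ht] with ω hω
  rw [hω]

theorem memLp_slice {n : ℕ} (X : L2 H (n + 1)) : MemLp (slice X) 2 volume := by
  rw [MemLp, eLpNorm_lt_top_iff_lintegral_rpow_enorm_lt_top (by norm_num) (by norm_num)]
  refine ⟨(measurable_slice X).aestronglyMeasurable, ?_⟩
  have h : ∫⁻ t, ‖slice X t‖ₑ ^ 2 < ∞ := by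
    rw [lintegral_enorm_sq_slice]; exact ENNReal.pow_lt_top enorm_lt_top
  simpa using h

theorem integral_cube_succ {n : ℕ} {f : Cube (n + 1) → ℝ} (hf : Integrable f) :
    ∫ ω, f ω = ∫ t : unitInterval, ∫ ω : Cube n, f (Fin.cons t ω) := by
  have hmp := measurePreserving_cubeCons n
  have h := integral_map (μ := volume) (f := f) hmp.measurable.aemeasurable
    (hmp.map_eq.symm ▸ hf.aestronglyMeasurable)
  rw [hmp.map_eq] at h
  rw [h, Measure.volume_eq_prod, integral_prod]
  exact hmp.integrable_comp_of_integrable hf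

theorem inner_eq_integral_slice {n : ℕ} (X Y : L2 H (n + 1)) :
    inner ℝ X Y = ∫ t, inner ℝ (slice X t) (slice Y t) := by
  rw [L2.inner_def, integral_cube_succ (L2.integrable_inner X Y)]
  refine integral_congr_ae ?_
  filter_upwards [slice_ae_eq X, slice_ae_eq Y] with t hX hY
  rw [L2.inner_def]
  refine integral_congr_ae ?_
  filter_upwards [hX, hY] with ω h1 h2
  rw [h1, h2]

theorem toMeasure_adLaw_L2 {n : ℕ} (X : L2 H (n + 1)) : (adLaw X).toMeasure =
    (volume : Measure unitInterval).map fun t => adLaw (slice X t) := by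
  rw [toMeasure_adLaw (measurable_coe_L2 X) (lintegral_enorm_sq_lt_top X)]
  refine Measure.map_congr ?_
  filter_upwards [slice_ae_eq X] with t ht
  exact (adLaw_congr ht).symm

theorem measurable_adLaw_slice {n : ℕ} (X : L2 H (n + 1)) :
    Measurable fun t => adLaw (slice X t) :=
  (measurable_adLaw_L2 n).comp (measurable_slice X)

/-- Every element of `P₂ⁿ(H)` is an adapted law, and the representing function can be chosen
measurably. -/
theorem exists_measurable_section (n : ℕ) :
    ∃ s : P2 H n → L2 H n, Measurable s ∧ ∀ p, adLaw (s p) = p := by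
  induction n with
  | zero =>
    have hm : Measurable (Function.uncurry fun (p : P2 H 0) (_ : Cube 0) => (show H from p)) :=
      measurable_fst
    refine ⟨fun p => toL2 fun _ => (show H from p), measurable_toL2 hm, fun p => ?_⟩
    have h := toL2_ae_eq (G := fun _ : Cube 0 => (show H from p)) measurable_const (by
      rw [lintegral_const]
      exact ENNReal.mul_lt_top (ENNReal.pow_lt_top enorm_lt_top) (measure_lt_top _ _))
    exact adLaw_congr h
  | succ n ih =>
    obtain ⟨s, hs, hsp⟩ := ih
    obtain ⟨ev, hev, hae⟩ := exists_measurable_representative (H := H) n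
    -- Push `P` to a law on `L₂` of the smaller cube. A uniform variable simulates it, measurably in
    -- `P`: the first coordinate acts as that noise, and the others are the arguments of the sampled
    -- function.
    let κ : Kernel (P2 H (n + 1)) (L2 H n) :=
      ⟨fun P => P.toMeasure.map s, (Measure.measurable_map s hs).comp P2.measurable_toMeasure⟩
    have : IsMarkovKernel κ := ⟨fun P => Measure.isProbabilityMeasure_map hs.aemeasurable⟩
    obtain ⟨f, hf, hfκ⟩ := κ.exists_measurable_map_eq_unitInterval
    have hfP : ∀ P, Measurable (f P) := fun P => hf.of_uncurry_left
    let G : P2 H (n + 1) → Cube (n + 1) → H := fun P ω => ev (f P (ω 0)) (Fin.tail ω)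
    have htail : Measurable (Fin.tail : Cube (n + 1) → Cube n) :=
      measurable_pi_iff.2 fun i => measurable_pi_apply _
    have hG : Measurable (Function.uncurry G) := by
      have h0 : Measurable fun z : P2 H (n + 1) × Cube (n + 1) => f z.1 (z.2 0) :=
        hf.comp (measurable_fst.prodMk ((measurable_pi_apply 0).comp measurable_snd))
      exact hev.comp (h0.prodMk (htail.comp measurable_snd))
    have hGP : ∀ P, Measurable (G P) := fun P => hG.of_uncurry_left
    have hcons : ∀ P t, (fun ω => G P (Fin.cons t ω)) = ev (f P t) := fun P t => by
      funext ω
      simp [G]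
    have hint : ∀ P, ∫⁻ ω, ‖G P ω‖ₑ ^ 2 < ∞ := by
      intro P
      rw [lintegral_cube_succ ((hGP P).enorm.pow_const 2)]
      have h1 : ∀ t, ∫⁻ ω : Cube n, ‖G P (Fin.cons t ω)‖ₑ ^ 2 = ‖f P t‖ₑ ^ 2 := by
        intro t
        rw [enorm_sq_eq_lintegral]
        refine lintegral_congr_ae ?_
        filter_upwards [hae (f P t)] with ω hω
        rw [← hω, ← hcons]
      simp_rw [h1]
      have hm : Measurable fun x : L2 H n => ‖x‖ₑ ^ 2 := measurable_enorm.pow_const 2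
      rw [← lintegral_map hm (hfP P), hfκ P]
      change ∫⁻ x, ‖x‖ₑ ^ 2 ∂(P.toMeasure.map s) < ∞
      rw [lintegral_map hm hs]
      simp_rw [← sqNorm_adLaw_L2, hsp]
      rw [← sqNorm_succ]
      exact sqNorm_lt_top P
    refine ⟨fun P => toL2 (G P), measurable_toL2 hG, fun P => ?_⟩
    rw [adLaw_congr (toL2_ae_eq (hGP P) (hint P))]
    apply P2.toMeasure_injective
    rw [toMeasure_adLaw (hGP P) (hint P)]
    simp_rw [hcons, adLaw_congr (hae _)]
    have h2 := Measure.map_map (μ := volume) (measurable_adLaw_L2 n) (hfP P)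
    refine h2.symm.trans ?_
    rw [hfκ P]
    change (P.toMeasure.map s).map _ = _
    rw [Measure.map_map (measurable_adLaw_L2 n) hs]
    have h3 : (fun X : L2 H n => adLaw (X : Cube n → H)) ∘ s = id := funext hsp
    rw [h3, Measure.map_id]

end IteratedTransport

namespace IteratedTransport

/-! ### Couplings of the uniform distribution -/

/-- The function `t ↦ |A ∩ [0, t]|` is continuous and increasing, so it attains the level `|A| s`,
and the sublevel set cuts `A` at the last such point. -/
theorem measure_inter_quantile (A : Set unitInterval) (s : unitInterval) :
    volume (A ∩ {t | (volume : Measure unitInterval).real (A ∩ Set.Iic t) ≤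
      (volume : Measure unitInterval).real A * s}) = volume A * ENNReal.ofReal s := by
  set g : unitInterval → ℝ := fun t => (volume : Measure unitInterval).real (A ∩ Set.Iic t)
  have hmono : Monotone g := fun x y hxy =>
    measureReal_mono (Set.inter_subset_inter_right _ (Set.Iic_subset_Iic.2 hxy))
  have hle : ∀ x y : unitInterval, x ≤ y → g y - g x ≤ (y : ℝ) - x := by
    intro x y hxy
    have h1 : A ∩ Set.Iic y ⊆ (A ∩ Set.Iic x) ∪ Set.Ioc x y := by
      rintro z ⟨hz, hzy⟩
      rcases le_or_gt z x with h | h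
      · exact Or.inl ⟨hz, h⟩
      · exact Or.inr ⟨h, hzy⟩
    have h2 : g y ≤ g x + (volume : Measure unitInterval).real (Set.Ioc x y) :=
      (measureReal_mono h1).trans (measureReal_union_le _ _)
    have h3 : (volume : Measure unitInterval).real (Set.Ioc x y) = (y : ℝ) - x := by
      rw [measureReal_def, unitInterval.volume_Ioc, ENNReal.toReal_ofReal]
      exact sub_nonneg.2 hxy
    linarith
  have hcont : Continuous g := by
    have hlip : LipschitzWith 1 g := by
      refine LipschitzWith.of_dist_le_mul fun x y => ?_
      rw [NNReal.coe_one, one_mul, Subtype.dist_eq, Real.dist_eq, Real.dist_eq]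
      rcases le_total x y with h | h
      · rw [abs_sub_comm, abs_of_nonneg (sub_nonneg.2 (hmono h)), abs_sub_comm,
          abs_of_nonneg (sub_nonneg.2 (show (x : ℝ) ≤ y from h))]
        exact hle x y h
      · rw [abs_of_nonneg (sub_nonneg.2 (hmono h)),
          abs_of_nonneg (sub_nonneg.2 (show (y : ℝ) ≤ x from h))]
        exact hle y x h
    exact hlip.continuous
  set m := (volume : Measure unitInterval).real A
  have hm : 0 ≤ m := measureReal_nonneg
  have h0 : g 0 ≤ m * s := by
    have h : g 0 ≤ (volume : Measure unitInterval).real (Set.Iic 0) :=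
      measureReal_mono Set.inter_subset_right
    rw [measureReal_def, unitInterval.volume_Iic] at h
    simp at h
    exact h.trans (mul_nonneg hm s.2.1)
  have h1 : m * s ≤ g 1 := by
    have h : g 1 = m := by
      have : Set.Iic (1 : unitInterval) = Set.univ := by
        ext x; simp [unitInterval.le_one']
      simp only [g, this, Set.inter_univ, m]
    rw [h]
    exact mul_le_of_le_one_right hm s.2.2
  obtain ⟨t₀, ht₀⟩ := mem_range_of_exists_le_of_exists_ge hcont ⟨0, h0⟩ ⟨1, h1⟩
  have hclosed : IsClosed {t | g t = m * s} := isClosed_eq hcont continuous_const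
  -- The greatest solution is taken so that the sublevel set includes any flat stretch at that
  -- level.
  obtain ⟨t, ht, hmax⟩ := hclosed.isCompact.exists_isGreatest ⟨t₀, ht₀⟩
  have hset : A ∩ {t | g t ≤ m * s} = A ∩ Set.Iic t := by
    ext x
    simp only [Set.mem_inter_iff, Set.mem_ofPred_eq, Set.mem_Iic]
    refine and_congr_right fun _ => ⟨fun hx => ?_, fun hx => (hmono hx).trans (le_of_eq ht)⟩
    by_contra hlt
    have hx' : g x = m * s := le_antisymm hx ((le_of_eq ht.symm).trans (hmono (not_le.1 hlt).le))
    exact hlt (hmax hx')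
  rw [hset, ← ofReal_measureReal, show (volume : Measure unitInterval).real (A ∩ Set.Iic t) = m * s
    from ht, ENNReal.ofReal_mul hm, ofReal_measureReal]

/-- `F` is the distribution function of the normalised restriction to `A`. When `A` is null the
division returns zero, and both sides vanish. -/
theorem exists_map_restrict_eq_smul (A : Set unitInterval) :
    ∃ F : unitInterval → unitInterval, Measurable F ∧
      ((volume : Measure unitInterval).restrict A).map F =
        volume A • (volume : Measure unitInterval) := by
  let g : unitInterval → ℝ := fun t =>
    (volume : Measure unitInterval).real (A ∩ Set.Iic t) / (volume : Measure unitInterval).real A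
  have hg : ∀ t, g t ∈ unitInterval := fun t =>
    ⟨div_nonneg measureReal_nonneg measureReal_nonneg,
      div_le_one_of_le₀ (measureReal_mono Set.inter_subset_left) measureReal_nonneg⟩
  have hF : Measurable fun t => (⟨g t, hg t⟩ : unitInterval) := by
    refine Monotone.measurable fun x y hxy => ?_
    refine Subtype.coe_le_coe.1 (div_le_div_of_nonneg_right ?_ measureReal_nonneg)
    exact measureReal_mono (Set.inter_subset_inter_right _ (Set.Iic_subset_Iic.2 hxy))
  refine ⟨_, hF, Measure.ext_of_Iic _ _ fun s => ?_⟩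
  rw [Measure.map_apply hF measurableSet_Iic, Measure.restrict_apply (hF measurableSet_Iic),
    Measure.smul_apply, unitInterval.volume_Iic, smul_eq_mul, ← measure_inter_quantile A s,
    Set.inter_comm]
  rcases eq_or_ne (volume A) 0 with h0 | h0
  · rw [measure_mono_null Set.inter_subset_left h0, measure_mono_null Set.inter_subset_left h0]
  · congr 1
    ext t
    have hpos : 0 < (volume : Measure unitInterval).real A :=
      ENNReal.toReal_pos h0 (measure_ne_top _ _)
    refine and_congr_right fun _ => ?_
    change g t ≤ s ↔ _
    rw [div_le_iff₀ hpos, mul_comm]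
    rfl

/-- A function on the unit interval with countably many values is independent of some uniformly
distributed function. -/
theorem exists_uniform_independent {j : unitInterval → ℕ} (hj : Measurable j) :
    ∃ U : unitInterval → unitInterval, Measurable U ∧
      (volume : Measure unitInterval).map (fun ω => (j ω, U ω)) =
        ((volume : Measure unitInterval).map j).prod volume := by
  let A : ℕ → Set unitInterval := fun n => j ⁻¹' {n}
  have hA : ∀ n, MeasurableSet (A n) := fun n => hj (measurableSet_singleton n)
  -- Applying to each level set of `j` its own distribution function makes the result uniform
  -- conditionally on `j`.
  choose F hF hlaw using fun n => exists_map_restrict_eq_smul (A n)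
  have hU : Measurable fun ω => F (j ω) ω := by
    have h : Measurable fun z : ℕ × unitInterval => F z.1 z.2 :=
      measurable_from_prod_countable_right hF
    exact h.comp (hj.prodMk measurable_id)
  refine ⟨fun ω => F (j ω) ω, hU, ?_⟩
  ext S hS
  have hSn : ∀ n, MeasurableSet (Prod.mk n ⁻¹' S) := fun n => measurable_prodMk_left hS
  have hT : ((fun ω => (j ω, F (j ω) ω)) ⁻¹' S) =
      ⋃ n, (F n ⁻¹' (Prod.mk n ⁻¹' S)) ∩ A n := by
    ext ω
    simp only [Set.mem_iUnion]
    exact ⟨fun h => ⟨j ω, h, rfl⟩, fun ⟨n, h, hn⟩ => by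
      have hn' : j ω = n := hn
      subst hn'
      exact h⟩
  have hdisj : Pairwise (Function.onFun Disjoint fun n => (F n ⁻¹' (Prod.mk n ⁻¹' S)) ∩ A n) := by
    intro a b hab
    refine Set.disjoint_left.2 fun ω h1 h2 => hab ?_
    exact h1.2.symm.trans h2.2
  have hsum : volume ((fun ω => (j ω, F (j ω) ω)) ⁻¹' S) =
      ∑' n, volume ((F n ⁻¹' (Prod.mk n ⁻¹' S)) ∩ A n) := by
    rw [hT]
    exact measure_iUnion hdisj fun n => (hF n (hSn n)).inter (hA n)
  have hterm : ∀ n, volume ((F n ⁻¹' (Prod.mk n ⁻¹' S)) ∩ A n) =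
      volume (A n) * (volume : Measure unitInterval) (Prod.mk n ⁻¹' S) := by
    intro n
    have e : volume (F n ⁻¹' (Prod.mk n ⁻¹' S) ∩ A n) =
        ((volume : Measure unitInterval).restrict (A n)).map (F n) (Prod.mk n ⁻¹' S) := by
      rw [Measure.map_apply (hF n) (hSn n), Measure.restrict_apply (hF n (hSn n))]
    rw [e, hlaw n]
    rfl
  have hprod : (((volume : Measure unitInterval).map j).prod volume) S =
      ∑' n, (volume : Measure unitInterval) (Prod.mk n ⁻¹' S) * volume (A n) := by
    rw [Measure.prod_apply hS]
    refine (lintegral_countable' _).trans (tsum_congr fun n => ?_)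
    rw [Measure.map_apply hj (measurableSet_singleton n)]
  rw [Measure.map_apply (hj.prodMk hU) hS, hsum, hprod]
  exact tsum_congr fun n => (hterm n).trans (mul_comm _ _)

/-- A coupling of two uniform distributions, with the second coordinate observed through a function
with countably many values, is realised by a map of the second coordinate. -/
theorem exists_map_realising_coupling {j : unitInterval → ℕ} (hj : Measurable j)
    {γ : Measure (unitInterval × unitInterval)} [IsProbabilityMeasure γ]
    (h2 : γ.map Prod.snd = volume) :
    ∃ S : unitInterval → unitInterval, Measurable S ∧
      (volume : Measure unitInterval).map (fun ω => (S ω, j ω)) = γ.map fun z => (z.1, j z.2) := by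
  -- Seeing `ω` only through `j` leaves the independent noise `U`, which simulates the conditional
  -- law under `γ` of the first coordinate given the label. Observing all of `ω` would leave no
  -- noise.
  obtain ⟨U, hU, hjU⟩ := exists_uniform_independent hj
  obtain ⟨f, hf, hfκ⟩ := (condDistrib Prod.fst (fun z => j z.2) γ).exists_measurable_map_eq_unitInterval
  have hj2 : Measurable fun z : unitInterval × unitInterval => j z.2 := hj.comp measurable_snd
  have hS : Measurable fun ω => f (j ω) (U ω) := hf.comp (hj.prodMk hU)
  have hF : Measurable fun z : ℕ × unitInterval => (z.1, f z.1 z.2) :=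
    measurable_fst.prodMk hf
  have key : (volume : Measure unitInterval).map (fun ω => (j ω, f (j ω) (U ω))) =
      γ.map fun z => (j z.2, z.1) := by
    rw [← compProd_map_condDistrib (X := fun z : unitInterval × unitInterval => j z.2)
      measurable_fst.aemeasurable]
    have h3 : γ.map (fun z => j z.2) = (volume : Measure unitInterval).map j := by
      rw [← h2, Measure.map_map hj measurable_snd]; rfl
    have h4 := Measure.map_map (μ := volume) hF (hj.prodMk hU)
    refine h4.symm.trans ?_
    rw [hjU, h3]
    ext S hS
    rw [Measure.map_apply hF hS, Measure.prod_apply (hF hS), Measure.compProd_apply hS]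
    refine lintegral_congr fun n => ?_
    rw [← hfκ n, Measure.map_apply hf.of_uncurry_left (measurable_prodMk_left hS)]
    rfl
  refine ⟨fun ω => f (j ω) (U ω), hS, ?_⟩
  have h5 := congrArg (Measure.map Prod.swap) key
  rw [Measure.map_map measurable_swap (hj.prodMk hS),
    Measure.map_map measurable_swap (hj2.prodMk measurable_fst)] at h5
  exact h5

/-- The conditional law given `f = w` lives on the fibre over `w`. Testing with preimages of
measurable sets avoids assuming that points of `W` are measurable. -/
theorem condDistrib_id_preimage {W : Type*} [MeasurableSpace W] {f : unitInterval → W}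
    (hf : Measurable f) {B : Set W} (hB : MeasurableSet B) :
    (fun w => condDistrib id f (volume : Measure unitInterval) w (f ⁻¹' B)) =ᵐ[volume.map f]
      B.indicator 1 := by
  refine ae_eq_of_forall_setLIntegral_eq_of_sigmaFinite
    (Kernel.measurable_coe _ (hf hB)) (measurable_one.indicator hB) fun C hC _ => ?_
  rw [← Measure.compProd_apply_prod hC (hf hB), compProd_map_condDistrib measurable_id.aemeasurable,
    Measure.map_apply (hf.prodMk measurable_id) (hC.prod (hf hB)), lintegral_indicator_one hB,
    Measure.restrict_apply hB, Measure.map_apply hf (hB.inter hC)]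
  congr 1
  ext ω
  simp [and_comm]

/-- A coupling of two image measures of the uniform distribution is the image of a coupling of two
uniform distributions. -/
theorem exists_coupling_lift {W W' : Type*} [MeasurableSpace W] [MeasurableSpace W']
    {f : unitInterval → W} {g : unitInterval → W'} (hf : Measurable f) (hg : Measurable g)
    {π : Measure (W × W')} (h1 : π.map Prod.fst = volume.map f) (h2 : π.map Prod.snd = volume.map g) :
    ∃ γ : Measure (unitInterval × unitInterval), IsProbabilityMeasure γ ∧
      γ.map Prod.fst = volume ∧ γ.map Prod.snd = volume ∧ γ.map (Prod.map f g) = π := by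
  have hπ : IsProbabilityMeasure π := by
    have : IsProbabilityMeasure (π.map Prod.fst) :=
      h1 ▸ Measure.isProbabilityMeasure_map hf.aemeasurable
    exact Measure.isProbabilityMeasure_of_map Prod.fst
  -- Draw `(w, w')` from `π`, then draw the two uniform points independently from their conditional
  -- laws given `f = w` and `g = w'`.
  let κ := condDistrib id f (volume : Measure unitInterval)
  let η := condDistrib id g (volume : Measure unitInterval)
  have hrect : ∀ A B, MeasurableSet A → MeasurableSet B →
      (π.bind (κ ∥ₖ η)) (A ×ˢ B) = ∫⁻ z, κ z.1 A * η z.2 B ∂π := by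
    intro A B hA hB
    rw [Measure.bind_apply (hA.prod hB) (Kernel.aemeasurable _)]
    refine lintegral_congr fun z => ?_
    rw [Kernel.parallelComp_apply, Measure.prod_prod]
  refine ⟨π.bind (κ ∥ₖ η), inferInstance, ?_, ?_, ?_⟩
  · ext A hA
    rw [Measure.map_apply measurable_fst hA, ← Set.prod_univ, hrect A _ hA MeasurableSet.univ]
    simp only [measure_univ, mul_one]
    rw [← lintegral_map (f := fun w => κ w A) (Kernel.measurable_coe _ hA) measurable_fst, h1]
    have h := condDistrib_comp_map (μ := (volume : Measure unitInterval)) hf.aemeasurable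
      measurable_id.aemeasurable
    rw [Measure.map_id] at h
    conv_rhs => rw [← h]
    rw [Measure.bind_apply hA (Kernel.aemeasurable _)]
  · ext A hA
    rw [Measure.map_apply measurable_snd hA, ← Set.univ_prod, hrect _ A MeasurableSet.univ hA]
    simp only [measure_univ, one_mul]
    rw [← lintegral_map (f := fun w => η w A) (Kernel.measurable_coe _ hA) measurable_snd, h2]
    have h := condDistrib_comp_map (μ := (volume : Measure unitInterval)) hg.aemeasurable
      measurable_id.aemeasurable
    rw [Measure.map_id] at h
    conv_rhs => rw [← h]
    rw [Measure.bind_apply hA (Kernel.aemeasurable _)]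
  · have hfg : Measurable (Prod.map f g) := hf.prodMap hg
    have : IsProbabilityMeasure ((π.bind (κ ∥ₖ η)).map (Prod.map f g)) :=
      Measure.isProbabilityMeasure_map hfg.aemeasurable
    refine Measure.ext_prod fun {B B'} hB hB' => ?_
    have hpre : Prod.map f g ⁻¹' B ×ˢ B' = (f ⁻¹' B) ×ˢ (g ⁻¹' B') := rfl
    rw [Measure.map_apply hfg (hB.prod hB'), hpre, hrect _ _ (hf hB) (hg hB')]
    have e1 := condDistrib_id_preimage hf hB
    have e2 := condDistrib_id_preimage hg hB'
    rw [← h1] at e1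
    rw [← h2] at e2
    have e1' := ae_of_ae_map measurable_fst.aemeasurable e1
    have e2' := ae_of_ae_map measurable_snd.aemeasurable e2
    rw [← lintegral_indicator_one (hB.prod hB')]
    refine lintegral_congr_ae ?_
    filter_upwards [e1', e2'] with z hz1 hz2
    rw [hz1, hz2]
    by_cases hb : z.1 ∈ B <;> by_cases hb' : z.2 ∈ B' <;> simp [hb, hb']

end IteratedTransport

namespace IteratedTransport

variable {H : Type u} [NormedAddCommGroup H] [InnerProductSpace ℝ H]
  [CompleteSpace H] [SecondCountableTopology H] [MeasurableSpace H] [BorelSpace H]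

/-! ### Adapted transports of the cube -/

variable (H) in
/-- A measure preserving map of the cube that preserves all adapted laws. -/
structure IsAdaptedTransport {n : ℕ} (T : Cube n → Cube n) : Prop where
  mp : MeasurePreserving T
  adLaw_comp : ∀ X : L2 H n, adLaw (Lp.compMeasurePreserving T mp X) = adLaw X

theorem inner_compMeasurePreserving {n : ℕ} {T : Cube n → Cube n} (hT : MeasurePreserving T)
    (X Y : L2 H n) : |inner ℝ (Lp.compMeasurePreserving T hT X) Y| ≤ ‖X‖ * ‖Y‖ := by
  have h := abs_real_inner_le_norm (Lp.compMeasurePreserving T hT X) Y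
  rwa [Lp.norm_compMeasurePreserving] at h

/-- The transport `(t, ω) ↦ (S t, R (c t) ω)`. -/
def glueTransport {n : ℕ} {ι : Type*} (S : unitInterval → unitInterval) (c : unitInterval → ι)
    (R : ι → Cube n → Cube n) (ω : Cube (n + 1)) : Cube (n + 1) :=
  Fin.cons (S (ω 0)) (R (c (ω 0)) (Fin.tail ω))

theorem glueTransport_cons {n : ℕ} {ι : Type*} (S : unitInterval → unitInterval)
    (c : unitInterval → ι) (R : ι → Cube n → Cube n) (t : unitInterval) (ω : Cube n) :
    glueTransport S c R (Fin.cons t ω) = Fin.cons (S t) (R (c t) ω) := by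
  simp [glueTransport]

/-- This is a skew product with measure preserving fibres; countability of `ι` makes the family `R`
jointly measurable. -/
theorem measurePreserving_glueTransport {n : ℕ} {ι : Type*} [Countable ι] [MeasurableSpace ι]
    [MeasurableSingletonClass ι] {S : unitInterval → unitInterval} {c : unitInterval → ι}
    {R : ι → Cube n → Cube n} (hS : MeasurePreserving S) (hc : Measurable c)
    (hR : ∀ i, MeasurePreserving (R i)) : MeasurePreserving (glueTransport S c R) := by
  have hRm : Measurable fun z : ι × Cube n => R z.1 z.2 :=
    measurable_from_prod_countable_right fun i => (hR i).measurable
  have hsk := hS.skew_product (g := fun t ω => R (c t) ω) (μc := volume) (μd := volume)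
    (hRm.comp ((hc.comp measurable_fst).prodMk measurable_snd))
    (ae_of_all _ fun t => (hR (c t)).map_eq)
  have hcons := measurePreserving_cubeCons n
  have hcomp := hcons.comp hsk
  have hgm : Measurable (glueTransport S c R) := by
    have htail : Measurable (Fin.tail : Cube (n + 1) → Cube n) :=
      measurable_pi_iff.2 fun i => measurable_pi_apply _
    have h0 : Measurable fun ω : Cube (n + 1) => ω 0 := measurable_pi_apply 0
    have h1 : Measurable fun ω : Cube (n + 1) => R (c (ω 0)) (Fin.tail ω) :=
      hRm.comp ((hc.comp h0).prodMk htail)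
    exact measurable_cubeCons.comp ((hS.measurable.comp h0).prodMk h1)
  refine ⟨hgm, ?_⟩
  conv_lhs => rw [← hcons.map_eq]
  rw [Measure.map_map hgm hcons.measurable]
  convert hcomp.map_eq using 2
  · funext z
    exact glueTransport_cons S c R z.1 z.2
  · exact Measure.volume_eq_prod _ _

theorem slice_glueTransport {n : ℕ} {ι : Type*} [Countable ι] [MeasurableSpace ι]
    [MeasurableSingletonClass ι] {S : unitInterval → unitInterval} {c : unitInterval → ι}
    {R : ι → Cube n → Cube n} (hS : MeasurePreserving S) (hc : Measurable c)
    (hR : ∀ i, MeasurePreserving (R i)) (X : L2 H (n + 1)) : ∀ᵐ t,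
    slice (Lp.compMeasurePreserving _ (measurePreserving_glueTransport hS hc hR) X) t =
      Lp.compMeasurePreserving (R (c t)) (hR (c t)) (slice X (S t)) := by
  have hmp := measurePreserving_glueTransport hS hc hR
  have h1 := ae_ae_of_ae_cube (Lp.coeFn_compMeasurePreserving X hmp)
  have h2 := slice_ae_eq (Lp.compMeasurePreserving _ hmp X)
  have h3 := hS.quasiMeasurePreserving.ae (slice_ae_eq X)
  filter_upwards [h1, h2, h3] with t h1 h2 h3
  refine Lp.ext ?_
  have h4 := (hR (c t)).quasiMeasurePreserving.ae h3
  filter_upwards [h1, h2, h4, Lp.coeFn_compMeasurePreserving (slice X (S t)) (hR (c t))]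
    with ω h1 h2 h4 h5
  rw [h2, h1, h5, Function.comp_apply, Function.comp_apply, h4, glueTransport_cons]

/-- The slice at `t` becomes the slice at `S t` composed with some `R i`. The latter keeps its
adapted law, and `S` keeps the law of these laws. -/
theorem isAdaptedTransport_glueTransport {n : ℕ} {ι : Type*} [Countable ι] [MeasurableSpace ι]
    [MeasurableSingletonClass ι] {S : unitInterval → unitInterval} {c : unitInterval → ι}
    {R : ι → Cube n → Cube n} (hS : MeasurePreserving S) (hc : Measurable c)
    (hR : ∀ i, IsAdaptedTransport H (R i)) : IsAdaptedTransport H (glueTransport S c R) := by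
  refine ⟨measurePreserving_glueTransport hS hc fun i => (hR i).mp, fun X => ?_⟩
  apply P2.toMeasure_injective
  rw [toMeasure_adLaw_L2, toMeasure_adLaw_L2]
  have h : (fun t => adLaw (slice (Lp.compMeasurePreserving _
      (measurePreserving_glueTransport hS hc fun i => (hR i).mp) X) t)) =ᵐ[volume]
      (fun t => adLaw (slice X t)) ∘ S := by
    filter_upwards [slice_glueTransport hS hc (fun i => (hR i).mp) X] with t ht
    rw [ht, (hR (c t)).adLaw_comp]
    rfl
  rw [Measure.map_congr h, ← Measure.map_map (measurable_adLaw_slice X) hS.measurable, hS.map_eq]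

/-! ### Maximal covariance as a supremum over adapted transports -/

variable (H) in
/-- The maximal covariance of two adapted laws is the supremum of the inner products over all
adapted rearrangements. -/
structure HasTransportDuality (n : ℕ) : Prop where
  inner_le : ∀ X Y : L2 H n, inner ℝ X Y ≤ MC n (adLaw X) (adLaw Y)
  exists_transport : ∀ X Y : L2 H n, ∀ ε > 0, ∃ (T : Cube n → Cube n)
    (hT : IsAdaptedTransport H T),
    MC n (adLaw X) (adLaw Y) - ε ≤ inner ℝ (Lp.compMeasurePreserving T hT.mp X) Y

namespace HasTransportDuality

variable {n : ℕ} (h : HasTransportDuality H n)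

include h

/-- A near-optimal transport for `(X, Y)` is a competitor for `(X', Y')`, and composition with it is
an isometry. -/
theorem MC_sub_le (X X' Y Y' : L2 H n) : MC n (adLaw X) (adLaw Y) ≤
    MC n (adLaw X') (adLaw Y') + ‖X - X'‖ * ‖Y‖ + ‖X'‖ * ‖Y - Y'‖ := by
  refine le_of_forall_pos_le_add fun ε hε => ?_
  obtain ⟨T, hT, hle⟩ := h.exists_transport X Y ε hε
  have h1 := h.inner_le (Lp.compMeasurePreserving T hT.mp X') Y'
  rw [hT.adLaw_comp] at h1
  have h2 := (abs_le.1 (inner_compMeasurePreserving hT.mp (X - X') Y)).2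
  have h3 := (abs_le.1 (inner_compMeasurePreserving hT.mp X' (Y - Y'))).2
  rw [map_sub, inner_sub_left] at h2
  rw [inner_sub_right] at h3
  linarith

theorem abs_MC_le (X Y : L2 H n) : |MC n (adLaw X) (adLaw Y)| ≤ ‖X‖ * ‖Y‖ := by
  refine abs_le.2 ⟨?_, ?_⟩
  · exact (abs_le.1 (abs_real_inner_le_norm X Y)).1.trans (h.inner_le X Y)
  · refine le_of_forall_pos_le_add fun ε hε => ?_
    obtain ⟨T, hT, hle⟩ := h.exists_transport X Y ε hε
    have h2 := (abs_le.1 (inner_compMeasurePreserving hT.mp X Y)).2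
    linarith

theorem continuous_MC : Continuous fun z : L2 H n × L2 H n => MC n (adLaw z.1) (adLaw z.2) := by
  refine continuous_iff_continuousAt.2 fun z => ?_
  refine tendsto_iff_dist_tendsto_zero.2 ?_
  have hlim : Filter.Tendsto (fun w : L2 H n × L2 H n =>
      ‖w.1 - z.1‖ * (‖w.2‖ + ‖z.2‖) + (‖z.1‖ + ‖w.1‖) * ‖w.2 - z.2‖) (nhds z) (nhds 0) := by
    have hc : Continuous fun w : L2 H n × L2 H n =>
      ‖w.1 - z.1‖ * (‖w.2‖ + ‖z.2‖) + (‖z.1‖ + ‖w.1‖) * ‖w.2 - z.2‖ := by fun_prop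
    simpa using hc.tendsto z
  refine squeeze_zero (fun _ => dist_nonneg) (fun w => ?_) hlim
  have h1 := h.MC_sub_le w.1 z.1 w.2 z.2
  have h2 := h.MC_sub_le z.1 w.1 z.2 w.2
  rw [norm_sub_rev z.1, norm_sub_rev z.2] at h2
  have p1 := mul_nonneg (norm_nonneg (w.1 - z.1)) (norm_nonneg w.2)
  have p2 := mul_nonneg (norm_nonneg (w.1 - z.1)) (norm_nonneg z.2)
  have p3 := mul_nonneg (norm_nonneg z.1) (norm_nonneg (w.2 - z.2))
  have p4 := mul_nonneg (norm_nonneg w.1) (norm_nonneg (w.2 - z.2))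
  rw [Real.dist_eq, abs_le]
  constructor <;> linarith

/-- A measurable section of the adapted law pulls the question back to a continuous function on `L₂
× L₂`. -/
theorem measurable_MC : Measurable fun z : P2 H n × P2 H n => MC n z.1 z.2 := by
  obtain ⟨s, hs, hsp⟩ := exists_measurable_section (H := H) n
  have heq : (fun z : P2 H n × P2 H n => MC n z.1 z.2) =
      (fun z : L2 H n × L2 H n => MC n (adLaw z.1) (adLaw z.2)) ∘ Prod.map s s := by
    funext z
    simp [hsp]
  rw [heq]
  exact h.continuous_MC.measurable.comp (hs.prodMap hs)

end HasTransportDuality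

theorem hasTransportDuality_zero : HasTransportDuality H 0 := by
  have key : ∀ X Y : L2 H 0, inner ℝ X Y = MC 0 (adLaw X) (adLaw Y) := by
    intro X Y
    have hc : ∀ ω : Cube 0, inner ℝ (X ω) (Y ω) = inner ℝ (X default) (Y default) := fun ω => by
      rw [Subsingleton.elim ω default]
    rw [L2.inner_def]
    simp_rw [hc]
    simp
    rfl
  refine ⟨fun X Y => (key X Y).le, fun X Y ε hε => ⟨id, ⟨MeasurePreserving.id _, fun X => ?_⟩, ?_⟩⟩
  · rw [Lp.compMeasurePreserving_id_apply]
  · rw [Lp.compMeasurePreserving_id_apply, key]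
    linarith

end IteratedTransport

/-! ### The induction step of the transport duality -/

namespace IteratedTransport

variable {H : Type u} [NormedAddCommGroup H] [InnerProductSpace ℝ H]
  [CompleteSpace H] [SecondCountableTopology H] [MeasurableSpace H] [BorelSpace H]

theorem integrable_inner_slice {n : ℕ} (X Y : L2 H (n + 1)) :
    Integrable fun t => inner ℝ (slice X t) (slice Y t) :=
  ((memLp_slice X).norm.integrable_mul (memLp_slice Y).norm).mono'
    ((measurable_slice X).inner (measurable_slice Y)).aestronglyMeasurable
    (ae_of_all _ fun _ => abs_real_inner_le_norm _ _)

theorem integrable_sub_const_mul {α : Type*} [MeasurableSpace α] {μ : Measure α}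
    [IsProbabilityMeasure μ] {f u v : α → ℝ} (hf : Integrable f μ) (hu : Integrable u μ)
    (hv : Integrable v μ) (δ a : ℝ) :
    Integrable (fun x => f x - δ * (a + (u x + v x))) μ ∧
      ∫ x, (f x - δ * (a + (u x + v x))) ∂μ =
        (∫ x, f x ∂μ) - δ * (a + ((∫ x, u x ∂μ) + ∫ x, v x ∂μ)) := by
  have huv : Integrable (fun x => u x + v x) μ := hu.add hv
  have ha : Integrable (fun x => a + (u x + v x)) μ := (integrable_const a).add huv
  refine ⟨hf.sub (ha.const_mul δ), ?_⟩
  rw [integral_sub hf (ha.const_mul δ), integral_const_mul, integral_add (integrable_const a) huv,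
    integral_add hu hv]
  simp

section Step

variable {n : ℕ} (h : HasTransportDuality H n) (X Y : L2 H (n + 1))
  {γ : Measure (unitInterval × unitInterval)} [IsProbabilityMeasure γ]
  (h1 : γ.map Prod.fst = volume) (h2 : γ.map Prod.snd = volume)

include h1 in
theorem memLp_slice_fst : MemLp (fun z => slice X z.1) 2 γ :=
  (memLp_slice X).comp_measurePreserving ⟨measurable_fst, h1⟩

include h2 in
theorem memLp_slice_snd : MemLp (fun z => slice Y z.2) 2 γ :=
  (memLp_slice Y).comp_measurePreserving ⟨measurable_snd, h2⟩

include h1 h2 in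
theorem integrable_norm_slice_add_mul (δ : ℝ) :
    Integrable (fun z => (‖slice X z.1‖ + δ) * (‖slice Y z.2‖ + δ)) γ :=
  MemLp.integrable_mul (p := 2) (q := 2)
    ((memLp_slice_fst X h1).norm.add (memLp_const δ))
    ((memLp_slice_snd Y h2).norm.add (memLp_const δ))

include h1 h2 in
-- The bound sees only the marginals, hence is uniform over couplings.
theorem integral_norm_slice_mul_le :
    ∫ z, ‖slice X z.1‖ * ‖slice Y z.2‖ ∂γ ≤
      (∫ t, ‖slice X t‖ ^ 2) + ∫ t, ‖slice Y t‖ ^ 2 := by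
  have e1 : ∫ t, ‖slice X t‖ ^ 2 = ∫ z, ‖slice X z.1‖ ^ 2 ∂γ := by
    conv_lhs => rw [← h1]
    exact integral_map measurable_fst.aemeasurable
      ((measurable_slice X).norm.pow_const 2).aestronglyMeasurable
  have e2 : ∫ t, ‖slice Y t‖ ^ 2 = ∫ z, ‖slice Y z.2‖ ^ 2 ∂γ := by
    conv_lhs => rw [← h2]
    exact integral_map measurable_snd.aemeasurable
      ((measurable_slice Y).norm.pow_const 2).aestronglyMeasurable
  have i1 := (memLp_slice_fst X h1).norm.integrable_sq
  have i2 := (memLp_slice_snd Y h2).norm.integrable_sq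
  rw [e1, e2, ← integral_add i1 i2]
  refine integral_mono ?_ (i1.add i2) fun z => ?_
  · simpa using integrable_norm_slice_add_mul X Y h1 h2 0
  · change ‖slice X z.1‖ * ‖slice Y z.2‖ ≤ ‖slice X z.1‖ ^ 2 + ‖slice Y z.2‖ ^ 2
    nlinarith [sq_nonneg (‖slice X z.1‖ - ‖slice Y z.2‖), sq_nonneg ‖slice X z.1‖,
      sq_nonneg ‖slice Y z.2‖]

include h h1 h2 in
theorem integrable_MC_slice :
    Integrable (fun z => MC n (adLaw (slice X z.1)) (adLaw (slice Y z.2))) γ := by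
  refine Integrable.mono' (g := fun z => ‖slice X z.1‖ * ‖slice Y z.2‖) ?_ ?_ ?_
  · simpa using integrable_norm_slice_add_mul X Y h1 h2 0
  · exact (h.measurable_MC.comp (((measurable_adLaw_slice X).comp measurable_fst).prodMk
      ((measurable_adLaw_slice Y).comp measurable_snd))).aestronglyMeasurable
  · exact ae_of_all _ fun z => h.abs_MC_le _ _

/-- The coupling of two laws of slices induced by a coupling of uniform distributions. -/
noncomputable def sliceCoupling (γ : Measure (unitInterval × unitInterval)) :
    Measure (P2 H n × P2 H n) :=
  γ.map (Prod.map (fun t => adLaw (slice X t)) fun t => adLaw (slice Y t))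

include h1 h2 in
theorem sliceCoupling_mem : sliceCoupling X Y γ ∈ Cpl (adLaw X).toMeasure (adLaw Y).toMeasure := by
  have hX := measurable_adLaw_slice X
  have hY := measurable_adLaw_slice Y
  constructor
  · rw [toMeasure_adLaw_L2, ← h1, Measure.map_map hX measurable_fst, sliceCoupling,
      Measure.map_map measurable_fst (hX.prodMap hY)]
    rfl
  · rw [toMeasure_adLaw_L2, ← h2, Measure.map_map hY measurable_snd, sliceCoupling,
      Measure.map_map measurable_snd (hX.prodMap hY)]
    rfl

theorem exists_eq_sliceCoupling {π : Measure (P2 H n × P2 H n)}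
    (hπ : π ∈ Cpl (adLaw X).toMeasure (adLaw Y).toMeasure) :
    ∃ γ : Measure (unitInterval × unitInterval), IsProbabilityMeasure γ ∧
      γ.map Prod.fst = volume ∧ γ.map Prod.snd = volume ∧ sliceCoupling X Y γ = π := by
  obtain ⟨hπ1, hπ2⟩ := hπ
  rw [toMeasure_adLaw_L2] at hπ1 hπ2
  exact exists_coupling_lift (measurable_adLaw_slice X) (measurable_adLaw_slice Y) hπ1 hπ2

include h in
theorem integral_sliceCoupling : ∫ z, MC n z.1 z.2 ∂(sliceCoupling X Y γ) =
    ∫ z, MC n (adLaw (slice X z.1)) (adLaw (slice Y z.2)) ∂γ :=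
  integral_map ((measurable_adLaw_slice X).prodMap (measurable_adLaw_slice Y)).aemeasurable
    h.measurable_MC.aestronglyMeasurable

include h in
-- A real supremum of an unbounded family is a default value, so boundedness is needed before `MC`
-- can be compared with single couplings.
theorem bddAbove_integral_coupling : BddAbove (Set.range
    fun π : Cpl (adLaw X).toMeasure (adLaw Y).toMeasure =>
      ∫ z, MC n z.1 z.2 ∂(π : Measure (P2 H n × P2 H n))) := by
  refine ⟨(∫ t, ‖slice X t‖ ^ 2) + ∫ t, ‖slice Y t‖ ^ 2, ?_⟩
  rintro _ ⟨⟨π, hπ⟩, rfl⟩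
  obtain ⟨γ, hγ, h1, h2, rfl⟩ := exists_eq_sliceCoupling X Y hπ
  change ∫ z, MC n z.1 z.2 ∂(sliceCoupling X Y γ) ≤ _
  rw [integral_sliceCoupling h]
  refine le_trans ?_ (integral_norm_slice_mul_le X Y h1 h2)
  refine integral_mono (integrable_MC_slice h X Y h1 h2) ?_ fun z =>
    (le_abs_self _).trans (h.abs_MC_le _ _)
  simpa using integrable_norm_slice_add_mul X Y h1 h2 0

include h h1 h2 in
theorem integral_MC_slice_le : ∫ z, MC n (adLaw (slice X z.1)) (adLaw (slice Y z.2)) ∂γ ≤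
    MC (n + 1) (adLaw X) (adLaw Y) := by
  rw [← integral_sliceCoupling h]
  exact le_ciSup (bddAbove_integral_coupling h X Y) ⟨_, sliceCoupling_mem X Y h1 h2⟩

theorem diagonal_marginals :
    IsProbabilityMeasure ((volume : Measure unitInterval).map fun t => (t, t)) ∧
    ((volume : Measure unitInterval).map fun t => (t, t)).map Prod.fst = volume ∧
    ((volume : Measure unitInterval).map fun t => (t, t)).map Prod.snd = volume := by
  have hm : Measurable fun t : unitInterval => (t, t) := measurable_id.prodMk measurable_id
  refine ⟨Measure.isProbabilityMeasure_map hm.aemeasurable, ?_, ?_⟩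
  · rw [Measure.map_map measurable_fst hm]; exact Measure.map_id
  · rw [Measure.map_map measurable_snd hm]; exact Measure.map_id

include h in
-- The diagonal coupling pairs slices at the same `t`, where the lower-dimensional inequality
-- applies.
theorem inner_le_MC_succ : inner ℝ X Y ≤ MC (n + 1) (adLaw X) (adLaw Y) := by
  have hm : Measurable fun t : unitInterval => (t, t) := measurable_id.prodMk measurable_id
  obtain ⟨hp, d1, d2⟩ := diagonal_marginals
  refine le_trans ?_ (integral_MC_slice_le h X Y d1 d2)
  have hint := integrable_MC_slice h X Y d1 d2
  rw [inner_eq_integral_slice, integral_map hm.aemeasurable hint.aestronglyMeasurable]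
  exact integral_mono (integrable_inner_slice X Y) (hint.comp_measurable hm)
    fun t => h.inner_le _ _

include h h1 h2 in
/-- A coupling of uniform distributions is almost realised by an adapted transport. -/
theorem exists_transport_of_coupling {δ : ℝ} (hδ : 0 < δ) :
    ∃ (T : Cube (n + 1) → Cube (n + 1)) (hT : IsAdaptedTransport H T),
      (∫ z, MC n (adLaw (slice X z.1)) (adLaw (slice Y z.2)) ∂γ) -
        δ * (1 + 2 * δ + 2 * ((∫ t, ‖slice X t‖) + ∫ t, ‖slice Y t‖)) ≤
      inner ℝ (Lp.compMeasurePreserving T hT.mp X) Y := by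
  obtain ⟨e, r, hr, her'⟩ := exists_measurable_net (E := L2 H n) (ENNReal.ofReal_pos.2 hδ)
  have her : ∀ x, ‖x - e (r x)‖ ≤ δ := fun x => by
    rw [← dist_eq_norm, ← edist_le_ofReal hδ.le]
    exact (her' x).le
  have hen : ∀ x, ‖e (r x)‖ ≤ ‖x‖ + δ := fun x => by
    have := norm_sub_norm_le (e (r x)) x
    have := her x
    rw [norm_sub_rev] at this
    linarith
  -- One near-optimal transport for each pair of net points: countably many choices, so gluing them
  -- is measurable.
  choose R hR hRle using fun c : ℕ × ℕ => h.exists_transport (e c.1) (e c.2) δ hδ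
  have hjY : Measurable fun t => r (slice Y t) := hr.comp (measurable_slice Y)
  have hiX : Measurable fun t => r (slice X t) := hr.comp (measurable_slice X)
  obtain ⟨S, hSm, hSlaw⟩ := exists_map_realising_coupling hjY h2
  have hφm : Measurable fun t => (S t, r (slice Y t)) := hSm.prodMk hjY
  have hψm : Measurable fun z : unitInterval × unitInterval => (z.1, r (slice Y z.2)) :=
    measurable_fst.prodMk (hjY.comp measurable_snd)
  have hS : MeasurePreserving S := by
    refine ⟨hSm, ?_⟩
    have h3 := congrArg (Measure.map Prod.fst) hSlaw
    rw [Measure.map_map measurable_fst hφm, Measure.map_map measurable_fst hψm] at h3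
    exact h3.trans h1
  have hc : Measurable fun t => (r (slice X (S t)), r (slice Y t)) := (hiX.comp hSm).prodMk hjY
  refine ⟨_, isAdaptedTransport_glueTransport hS hc hR, ?_⟩
  set Z := Lp.compMeasurePreserving _ (isAdaptedTransport_glueTransport hS hc hR).mp X
  let m : ℕ × ℕ → ℝ := fun c => MC n (adLaw (e c.1)) (adLaw (e c.2))
  -- The discretised value sees the second variable only through its label, so its integral under
  -- `γ` is reproduced exactly by `S`.
  let q : unitInterval × ℕ → ℝ := fun w => m (r (slice X w.1), w.2)
  have hq : Measurable q :=
    (measurable_of_countable m).comp ((hiX.comp measurable_fst).prodMk measurable_snd)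
  have hqγ : Integrable (fun z => q (z.1, r (slice Y z.2))) γ := by
    refine (integrable_norm_slice_add_mul X Y h1 h2 δ).mono'
      (hq.comp hψm).aestronglyMeasurable (ae_of_all _ fun z => ?_)
    exact (h.abs_MC_le _ _).trans
      (mul_le_mul (hen _) (hen _) (norm_nonneg _) (add_nonneg (norm_nonneg _) hδ.le))
  have hqmap : Integrable q (γ.map fun z => (z.1, r (slice Y z.2))) :=
    (integrable_map_measure hq.aestronglyMeasurable hψm.aemeasurable).2 hqγ
  have hqvol : Integrable fun t => q (S t, r (slice Y t)) := by
    rw [← hSlaw] at hqmap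
    exact hqmap.comp_measurable hφm
  have hqeq : ∫ t, q (S t, r (slice Y t)) = ∫ z, q (z.1, r (slice Y z.2)) ∂γ := by
    rw [← integral_map (f := q) hφm.aemeasurable hq.aestronglyMeasurable, hSlaw,
      integral_map hψm.aemeasurable hq.aestronglyMeasurable]
  have hnX : Integrable fun t => ‖slice X t‖ :=
    ((memLp_slice X).integrable (by norm_num)).norm
  have hnY : Integrable fun t => ‖slice Y t‖ :=
    ((memLp_slice Y).integrable (by norm_num)).norm
  have hnXS : Integrable fun t => ‖slice X (S t)‖ := hS.integrable_comp_of_integrable hnX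
  have hmX : Measurable fun t => ‖slice X t‖ := (measurable_slice X).norm
  have hmY : Measurable fun t => ‖slice Y t‖ := (measurable_slice Y).norm
  have hXS : ∫ t, ‖slice X (S t)‖ = ∫ t, ‖slice X t‖ := by
    conv_rhs => rw [← hS.map_eq]
    exact (integral_map hSm.aemeasurable hmX.aestronglyMeasurable).symm
  have hX1 : ∫ z, ‖slice X z.1‖ ∂γ = ∫ t, ‖slice X t‖ := by
    conv_rhs => rw [← h1]
    exact (integral_map measurable_fst.aemeasurable hmX.aestronglyMeasurable).symm
  have hY2 : ∫ z, ‖slice Y z.2‖ ∂γ = ∫ t, ‖slice Y t‖ := by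
    conv_rhs => rw [← h2]
    exact (integral_map measurable_snd.aemeasurable hmY.aestronglyMeasurable).symm
  have hnX1 : Integrable (fun z => ‖slice X z.1‖) γ :=
    ((memLp_slice_fst X h1).integrable (by norm_num)).norm
  have hnY2 : Integrable (fun z => ‖slice Y z.2‖) γ :=
    ((memLp_slice_snd Y h2).integrable (by norm_num)).norm
  -- Per slice pair `a, b`, the loss is `δ` from near-optimality, `δ‖b‖` from moving `a` to the net,
  -- and `(‖a‖ + δ)δ` from moving `b`.
  have step1 : (∫ t, q (S t, r (slice Y t))) -
      δ * (1 + δ + ((∫ t, ‖slice X t‖) + ∫ t, ‖slice Y t‖)) ≤ inner ℝ Z Y := by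
    obtain ⟨hint, hval⟩ := integrable_sub_const_mul hqvol hnXS hnY δ (1 + δ)
    rw [hXS] at hval
    rw [← hval, inner_eq_integral_slice]
    refine integral_mono_ae hint (integrable_inner_slice Z Y) ?_
    filter_upwards [slice_glueTransport hS hc (fun i => (hR i).mp) X] with t ht
    change q (S t, r (slice Y t)) - δ * (1 + δ + (‖slice X (S t)‖ + ‖slice Y t‖)) ≤
      inner ℝ (slice Z t) (slice Y t)
    rw [ht]
    set a := slice X (S t)
    set b := slice Y t
    have k1 := hRle (r a, r b)
    have k2 := (abs_le.1 (inner_compMeasurePreserving (hR (r a, r b)).mp (a - e (r a)) b)).1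
    have k3 := (abs_le.1
      (inner_compMeasurePreserving (hR (r a, r b)).mp (e (r a)) (b - e (r b)))).1
    rw [map_sub, inner_sub_left] at k2
    rw [inner_sub_right] at k3
    have k4 : ‖a - e (r a)‖ * ‖b‖ ≤ δ * ‖b‖ := mul_le_mul_of_nonneg_right (her a) (norm_nonneg _)
    have k5 : ‖e (r a)‖ * ‖b - e (r b)‖ ≤ (‖a‖ + δ) * δ :=
      mul_le_mul (hen a) (her b) (norm_nonneg _) (add_nonneg (norm_nonneg _) hδ.le)
    change m (r a, r b) - _ ≤ _
    change m (r a, r b) - δ ≤ _ at k1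
    linarith
  -- The same two net errors, now through the Lipschitz estimate for `MC`.
  have step2 : (∫ z, MC n (adLaw (slice X z.1)) (adLaw (slice Y z.2)) ∂γ) -
      δ * (δ + ((∫ t, ‖slice X t‖) + ∫ t, ‖slice Y t‖)) ≤
      ∫ z, q (z.1, r (slice Y z.2)) ∂γ := by
    have hM := integrable_MC_slice h X Y h1 h2
    obtain ⟨hint, hval⟩ := integrable_sub_const_mul hM hnX1 hnY2 δ δ
    rw [hX1, hY2] at hval
    rw [← hval]
    refine integral_mono hint hqγ fun z => ?_
    change MC n (adLaw (slice X z.1)) (adLaw (slice Y z.2)) -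
      δ * (δ + (‖slice X z.1‖ + ‖slice Y z.2‖)) ≤ m (r (slice X z.1), r (slice Y z.2))
    set a := slice X z.1
    set b := slice Y z.2
    have k1 := h.MC_sub_le a (e (r a)) b (e (r b))
    have k4 : ‖a - e (r a)‖ * ‖b‖ ≤ δ * ‖b‖ := mul_le_mul_of_nonneg_right (her a) (norm_nonneg _)
    have k5 : ‖e (r a)‖ * ‖b - e (r b)‖ ≤ (‖a‖ + δ) * δ :=
      mul_le_mul (hen a) (her b) (norm_nonneg _) (add_nonneg (norm_nonneg _) hδ.le)
    change _ ≤ MC n (adLaw (e (r a))) (adLaw (e (r b)))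
    linarith
  rw [hqeq] at step1
  linarith

include h in
theorem exists_transport_succ {ε : ℝ} (hε : 0 < ε) : ∃ (T : Cube (n + 1) → Cube (n + 1))
    (hT : IsAdaptedTransport H T),
    MC (n + 1) (adLaw X) (adLaw Y) - ε ≤ inner ℝ (Lp.compMeasurePreserving T hT.mp X) Y := by
  obtain ⟨hp, d1, d2⟩ := diagonal_marginals
  have hne : Nonempty (Cpl (adLaw X).toMeasure (adLaw Y).toMeasure) :=
    ⟨⟨_, sliceCoupling_mem X Y d1 d2⟩⟩
  obtain ⟨⟨π, hπ⟩, hlt⟩ := exists_lt_of_lt_ciSup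
    (show MC (n + 1) (adLaw X) (adLaw Y) - ε / 2 < MC (n + 1) (adLaw X) (adLaw Y) by linarith)
  obtain ⟨γ, hγ, h1, h2, rfl⟩ := exists_eq_sliceCoupling X Y hπ
  change _ < ∫ z, MC n z.1 z.2 ∂(sliceCoupling X Y γ) at hlt
  rw [integral_sliceCoupling h] at hlt
  set C := (∫ t, ‖slice X t‖) + ∫ t, ‖slice Y t‖
  have hC : 0 ≤ C := add_nonneg (integral_nonneg fun _ => norm_nonneg _)
    (integral_nonneg fun _ => norm_nonneg _)
  have hpos : 0 < 3 + 2 * C := by linarith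
  -- With `δ ≤ 1` the error factor `1 + 2δ + 2C` is at most `3 + 2C`.
  set δ := min 1 (ε / 2 / (3 + 2 * C))
  have hδ : 0 < δ := lt_min one_pos (by positivity)
  obtain ⟨T, hT, hle⟩ := exists_transport_of_coupling h X Y h1 h2 hδ
  refine ⟨T, hT, ?_⟩
  have hδ1 : δ ≤ 1 := min_le_left _ _
  have hδ2 : δ * (3 + 2 * C) ≤ ε / 2 := (le_div_iff₀ hpos).1 (min_le_right _ _)
  have hδ3 : δ * (1 + 2 * δ + 2 * C) ≤ δ * (3 + 2 * C) :=
    mul_le_mul_of_nonneg_left (by linarith) hδ.le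
  linarith

end Step

theorem hasTransportDuality (n : ℕ) : HasTransportDuality H n := by
  induction n with
  | zero => exact hasTransportDuality_zero
  | succ n ih =>
    exact ⟨inner_le_MC_succ ih, fun X Y ε hε => exists_transport_succ ih X Y hε⟩

end IteratedTransport

/-! ### The Fenchel–Moreau theorem -/

section FenchelMoreau

variable {E : Type*} [NormedAddCommGroup E] [InnerProductSpace ℝ E]

/-- Rearrangements attain `MC` only approximately; this passes to the limit. -/
theorem EReal.coe_sub_le_of_forall_lt {s r : ℝ} {x : EReal}
    (h : ∀ d : ℝ, d < s → ((d - r : ℝ) : EReal) ≤ x) : (s : EReal) - (r : EReal) ≤ x := by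
  rw [← EReal.coe_sub]
  refine le_of_forall_lt_imp_le_of_dense fun c hc => ?_
  obtain ⟨d, hcd, hd⟩ := EReal.lt_iff_exists_real_btwn.1 hc
  have hd' : d < s - r := EReal.coe_lt_coe_iff.1 hd
  have := h (d + r) (by linarith)
  rw [_root_.add_sub_cancel_right] at this
  exact hcd.le.trans this

theorem EReal.eq_top_or_exists_coe {x : EReal} (hx : x ≠ ⊥) : x = ⊤ ∨ ∃ r : ℝ, x = r := by
  induction x with
  | bot => exact absurd rfl hx
  | top => exact Or.inl rfl
  | coe r => exact Or.inr ⟨r, rfl⟩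

theorem lowerSemicontinuous_convexConjugate {F : E → EReal} (hF : ∀ x, F x ≠ ⊥) :
    LowerSemicontinuous (convexConjugate F) := by
  refine lowerSemicontinuous_iSup fun x => ?_
  rcases EReal.eq_top_or_exists_coe (hF x) with h | ⟨r, h⟩
  · simp only [h, EReal.sub_top]
    exact lowerSemicontinuous_const
  · simp only [h, ← EReal.coe_sub]
    exact (continuous_coe_real_ereal.comp (by fun_prop)).lowerSemicontinuous

theorem isConvexFun_convexConjugate {F : E → EReal} (hF : ∀ x, F x ≠ ⊥) :
    IsConvexFun (convexConjugate F) := by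
  intro y z a b ha hb hab
  refine iSup_le fun x => ?_
  rcases EReal.eq_top_or_exists_coe (hF x) with h | ⟨r, h⟩
  · simp [h]
  · have key : ∀ w, ((inner ℝ x w - r : ℝ) : EReal) ≤ convexConjugate F w := fun w => by
      rw [EReal.coe_sub, ← h]
      exact le_iSup (fun x => ((inner ℝ x w : ℝ) : EReal) - F x) x
    have e : inner ℝ x (a • y + b • z) - r = a * (inner ℝ x y - r) + b * (inner ℝ x z - r) := by
      rw [inner_add_right, inner_smul_right, inner_smul_right]
      linear_combination r * hab
    rw [h, ← EReal.coe_sub, e, EReal.coe_add, EReal.coe_mul, EReal.coe_mul]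
    exact add_le_add
      (mul_le_mul_of_nonneg_left (key y) (EReal.coe_nonneg.2 ha.le))
      (mul_le_mul_of_nonneg_left (key z) (EReal.coe_nonneg.2 hb.le))

theorem convexConjugate_le_of_affine_le {F : E → EReal} {y : E} {c : ℝ}
    (h : ∀ z, ((inner ℝ y z + c : ℝ) : EReal) ≤ F z) : convexConjugate F y ≤ ((-c : ℝ) : EReal) := by
  refine iSup_le fun z => ?_
  have h1 := EReal.sub_le_sub (le_refl ((inner ℝ z y : ℝ) : EReal)) (h z)
  refine h1.trans ?_
  rw [← EReal.coe_sub, real_inner_comm]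
  exact EReal.coe_le_coe_iff.2 (by linarith)

theorem convexConjugate_convexConjugate_le {F : E → EReal} (hF : ∀ x, F x ≠ ⊥) (x : E) :
    convexConjugate (convexConjugate F) x ≤ F x := by
  refine iSup_le fun y => ?_
  rcases EReal.eq_top_or_exists_coe (hF x) with h | ⟨r, h⟩
  · simp [h]
  · have h1 : ((inner ℝ x y - r : ℝ) : EReal) ≤ convexConjugate F y := by
      rw [EReal.coe_sub, ← h]
      exact le_iSup (fun x => ((inner ℝ x y : ℝ) : EReal) - F x) x
    refine (EReal.sub_le_sub le_rfl h1).trans ?_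
    rw [← EReal.coe_sub, h, real_inner_comm]
    exact EReal.coe_le_coe_iff.2 (by linarith)

theorem isClosed_epigraph_real {F : E → EReal} (hF : LowerSemicontinuous F) :
    IsClosed {p : E × ℝ | F p.1 ≤ (p.2 : EReal)} := by
  have h : IsClosed {p : E × EReal | F p.1 ≤ p.2} :=
    lowerSemicontinuous_iff_isClosed_epigraph.1 hF
  exact h.preimage (continuous_fst.prodMk (continuous_coe_real_ereal.comp continuous_snd))

theorem IsConvexFun.convex_epigraph {F : E → EReal} (hF : IsConvexFun F) :
    Convex ℝ {p : E × ℝ | F p.1 ≤ (p.2 : EReal)} := by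
  refine convex_iff_forall_pos.2 fun p hp q hq a b ha hb hab => ?_
  refine (hF p.1 q.1 a b ha hb hab).trans ?_
  change _ ≤ ((a * p.2 + b * q.2 : ℝ) : EReal)
  rw [EReal.coe_add, EReal.coe_mul, EReal.coe_mul]
  exact add_le_add
    (mul_le_mul_of_nonneg_left hp (EReal.coe_nonneg.2 ha.le))
    (mul_le_mul_of_nonneg_left hq (EReal.coe_nonneg.2 hb.le))

/-- Hahn–Banach in `E × ℝ` separates a point strictly below the graph from the closed convex
epigraph. -/
theorem exists_separating_of_lt {F : E → EReal} (hlsc : LowerSemicontinuous F)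
    (hconv : IsConvexFun F) {x : E} {a : ℝ} (hax : (a : EReal) < F x) :
    ∃ (u : E →L[ℝ] ℝ) (s b : ℝ), u x + s * a < b ∧
      ∀ z (t : ℝ), F z ≤ t → b < u z + s * t := by
  obtain ⟨L, b, hL1, hL2⟩ := geometric_hahn_banach_point_closed hconv.convex_epigraph
    (isClosed_epigraph_real hlsc) (show (x, a) ∉ _ from not_le.2 hax)
  have hsplit : ∀ z (t : ℝ), L (z, t) = L.comp (.inl ℝ E ℝ) z + L (0, 1) * t := by
    intro z t
    have e : ((z, t) : E × ℝ) = (z, 0) + t • ((0, 1) : E × ℝ) := by simp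
    rw [e, map_add, map_smul]
    simp [mul_comm]
  exact ⟨L.comp (.inl ℝ E ℝ), L (0, 1), b, hsplit x a ▸ hL1, fun z t h => hsplit z t ▸ hL2 _ h⟩

/-- A non-vertical hyperplane, solved for the last coordinate, is an affine minorant with value `a`
at `x`. -/
theorem affine_le_of_separating {F : E → EReal} (hbot : ∀ x, F x ≠ ⊥) {x : E} {a : ℝ}
    {u : E →L[ℝ] ℝ} {s b : ℝ} (hs : 0 < s) (h1 : u x + s * a < b)
    (h2 : ∀ z (t : ℝ), F z ≤ t → b < u z + s * t) (z : E) :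
    (((-s⁻¹ • u) z + (a + s⁻¹ * u x) : ℝ) : EReal) ≤ F z := by
  rcases EReal.eq_top_or_exists_coe (hbot z) with h | ⟨r, h⟩
  · simp [h]
  · have h3 := h2 z r h.le
    rw [h]
    refine EReal.coe_le_coe_iff.2 ?_
    have h4 : s⁻¹ * (u x + s * a) ≤ s⁻¹ * (u z + s * r) :=
      mul_le_mul_of_nonneg_left (h1.trans h3).le (inv_pos.2 hs).le
    have h5 : s⁻¹ * (u x + s * a) = s⁻¹ * u x + a := by field_simp
    have h6 : s⁻¹ * (u z + s * r) = s⁻¹ * u z + r := by field_simp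
    simp only [smul_apply, smul_eq_mul]
    linarith

/-- A proper lower semicontinuous convex function is the supremum of its affine minorants. -/
theorem exists_affine_le_of_lt {F : E → EReal} (hlsc : LowerSemicontinuous F)
    (hconv : IsConvexFun F) (hprop : IteratedTransport.IsProper F) {x : E} {a : ℝ}
    (hax : (a : EReal) < F x) :
    ∃ (l : E →L[ℝ] ℝ) (c : ℝ), (∀ z, ((l z + c : ℝ) : EReal) ≤ F z) ∧ a ≤ l x + c := by
  obtain ⟨hbot, x₀, hx₀⟩ := hprop
  -- Where `F` is finite the hyperplane cannot be vertical, since it separates two points of the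
  -- same vertical line.
  have hfin : ∀ {x : E} {a : ℝ}, (a : EReal) < F x → F x ≠ ⊤ →
      ∃ (l : E →L[ℝ] ℝ) (c : ℝ), (∀ z, ((l z + c : ℝ) : EReal) ≤ F z) ∧ a ≤ l x + c := by
    intro x a hax hx
    obtain ⟨u, s, b, h1, h2⟩ := exists_separating_of_lt hlsc hconv hax
    obtain ⟨r, hr⟩ := (EReal.eq_top_or_exists_coe (hbot x)).resolve_left hx
    have h3 := h2 x r hr.le
    rw [hr] at hax
    have har : a < r := EReal.coe_lt_coe_iff.1 hax
    have hs : 0 < s := by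
      by_contra hs
      have : s * r ≤ s * a := mul_le_mul_of_nonpos_left har.le (not_lt.1 hs)
      linarith
    exact ⟨_, _, affine_le_of_separating hbot hs h1 h2, by simp⟩
  by_cases hx : F x = ⊤
  · obtain ⟨u, s, b, h1, h2⟩ := exists_separating_of_lt hlsc hconv hax
    obtain ⟨r₀, hr₀⟩ := (EReal.eq_top_or_exists_coe (hbot x₀)).resolve_left hx₀
    have hs : 0 ≤ s := by
      by_contra hs
      have hs' : 0 < -s := by linarith
      -- A negative `s` fails because the epigraph contains `(x₀, t)` for arbitrarily large `t`;
      -- this `t` is large enough.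
      set t := max r₀ ((u x₀ - b) / -s)
      have h3 := h2 x₀ t (hr₀.le.trans (EReal.coe_le_coe_iff.2 (le_max_left _ _)))
      have h4 : (u x₀ - b) ≤ t * -s := (div_le_iff₀ hs').1 (le_max_right _ _)
      linarith
    rcases hs.lt_or_eq with hs | rfl
    · exact ⟨_, _, affine_le_of_separating hbot hs h1 h2, by simp⟩
    -- For a vertical hyperplane, `b - u` is negative on the domain of `F` and positive at `x`.
    -- Adding a large multiple of it to a minorant obtained at `x₀` keeps a minorant and raises its
    -- value at `x` to `a`.
    · simp only [zero_mul, add_zero] at h1 h2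
      obtain ⟨l, c, hl, -⟩ := hfin (x := x₀) (a := r₀ - 1)
        (by rw [hr₀]; exact EReal.coe_lt_coe_iff.2 (by linarith)) hx₀
      have hpos : 0 < b - u x := by linarith
      set k := max 0 ((a - (l x + c)) / (b - u x))
      have hk : 0 ≤ k := le_max_left _ _
      have hk2 : a - (l x + c) ≤ k * (b - u x) := (div_le_iff₀ hpos).1 (le_max_right _ _)
      refine ⟨l - k • u, c + k * b, fun z => ?_, ?_⟩
      · rcases EReal.eq_top_or_exists_coe (hbot z) with h | ⟨r, h⟩
        · simp [h]
        · have h3 := h2 z r h.le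
          have h4 := hl z
          rw [h] at h4 ⊢
          have h5 := EReal.coe_le_coe_iff.1 h4
          have h6 : k * (b - u z) ≤ 0 := mul_nonpos_of_nonneg_of_nonpos hk (by linarith)
          refine EReal.coe_le_coe_iff.2 ?_
          simp only [sub_apply, smul_apply, smul_eq_mul]
          linarith
      · simp only [sub_apply, smul_apply, smul_eq_mul]
        linarith
  · exact hfin hax hx

variable [CompleteSpace E]

theorem exists_inner_affine_le_of_lt {F : E → EReal} (hlsc : LowerSemicontinuous F)
    (hconv : IsConvexFun F) (hprop : IteratedTransport.IsProper F) {x : E} {a : ℝ}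
    (hax : (a : EReal) < F x) :
    ∃ (y : E) (c : ℝ), (∀ z, ((inner ℝ y z + c : ℝ) : EReal) ≤ F z) ∧ a ≤ inner ℝ y x + c := by
  obtain ⟨l, c, h1, h2⟩ := exists_affine_le_of_lt hlsc hconv hprop hax
  refine ⟨(InnerProductSpace.toDual ℝ E).symm l, c, ?_, ?_⟩
  · simpa only [InnerProductSpace.toDual_symm_apply] using h1
  · simpa only [InnerProductSpace.toDual_symm_apply] using h2

theorem isProper_convexConjugate {F : E → EReal} (hlsc : LowerSemicontinuous F)
    (hconv : IsConvexFun F) (hprop : IteratedTransport.IsProper F) :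
    IteratedTransport.IsProper (convexConjugate F) := by
  obtain ⟨hbot, x₀, hx₀⟩ := hprop
  obtain ⟨r₀, hr₀⟩ := (EReal.eq_top_or_exists_coe (hbot x₀)).resolve_left hx₀
  refine ⟨fun y hy => ?_, ?_⟩
  · have h := le_iSup (fun x => ((inner ℝ x y : ℝ) : EReal) - F x) x₀
    change _ ≤ convexConjugate F y at h
    rw [hy, hr₀, ← EReal.coe_sub, le_bot_iff] at h
    exact EReal.coe_ne_bot _ h
  · obtain ⟨y, c, hy, -⟩ := exists_inner_affine_le_of_lt hlsc hconv ⟨hbot, x₀, hx₀⟩ (x := x₀)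
      (a := r₀ - 1) (by rw [hr₀]; exact EReal.coe_lt_coe_iff.2 (by linarith))
    exact ⟨y, ((convexConjugate_le_of_affine_le hy).trans_lt (EReal.coe_lt_top _)).ne⟩

/-- An affine minorant with slope `y` and constant `d` gives `F*(y) ≤ -d`, so the biconjugate
dominates it; `F` is the supremum of such minorants. -/
theorem convexConjugate_convexConjugate {F : E → EReal} (hlsc : LowerSemicontinuous F)
    (hconv : IsConvexFun F) (hprop : IteratedTransport.IsProper F) :
    convexConjugate (convexConjugate F) = F := by
  funext x
  refine le_antisymm (convexConjugate_convexConjugate_le hprop.1 x) ?_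
  refine le_of_forall_lt_imp_le_of_dense fun c hc => ?_
  obtain ⟨a, hca, ha⟩ := EReal.lt_iff_exists_real_btwn.1 hc
  obtain ⟨y, d, hy, hax⟩ := exists_inner_affine_le_of_lt hlsc hconv hprop ha
  refine hca.le.trans ((EReal.coe_le_coe_iff.2 hax).trans ?_)
  refine le_trans ?_ (le_iSup (fun y => ((inner ℝ y x : ℝ) : EReal) - convexConjugate F y) y)
  have h1 := EReal.sub_le_sub (le_refl ((inner ℝ y x : ℝ) : EReal))
    (convexConjugate_le_of_affine_le hy)
  refine le_trans (le_of_eq ?_) h1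
  rw [← EReal.coe_sub, sub_neg_eq_add]

end FenchelMoreau

namespace IteratedTransport

variable {H : Type u} [NormedAddCommGroup H] [InnerProductSpace ℝ H]
  [CompleteSpace H] [SecondCountableTopology H] [MeasurableSpace H] [BorelSpace H] {N : ℕ}

/-! ### Conjugates of adapted Lions lifts -/

theorem adaptedLaw_surjective : Function.Surjective (adaptedLaw : L2 H N → P2 H N) := by
  intro P
  obtain ⟨s, -, hs⟩ := exists_measurable_section (H := H) N
  exact ⟨s P, (adaptedLaw_eq_adLaw _).trans (hs P)⟩

theorem inner_le_MC_adaptedLaw (X Y : L2 H N) :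
    inner ℝ X Y ≤ MC N (adaptedLaw X) (adaptedLaw Y) := by
  rw [adaptedLaw_eq_adLaw, adaptedLaw_eq_adLaw]
  exact (hasTransportDuality N).inner_le X Y

theorem exists_rearrangement (X Y : L2 H N) {d : ℝ}
    (hd : d < MC N (adaptedLaw X) (adaptedLaw Y)) :
    ∃ X' : L2 H N, adaptedLaw X' = adaptedLaw X ∧ d ≤ inner ℝ X' Y := by
  obtain ⟨T, hT, hle⟩ := (hasTransportDuality N).exists_transport X Y _ (sub_pos.2 hd)
  refine ⟨Lp.compMeasurePreserving T hT.mp X, ?_, ?_⟩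
  · rw [adaptedLaw_eq_adLaw, adaptedLaw_eq_adLaw, hT.adLaw_comp]
  · rwa [← adaptedLaw_eq_adLaw, ← adaptedLaw_eq_adLaw, sub_sub_cancel] at hle

/-- One inequality is `⟨X, Y⟩ ≤ MC`. For the other, `P` is realised by some `X`, which is rearranged
against `Y` without changing the value of the lift. -/
theorem convexConjugate_lionsLift {φ : P2 H N → EReal} (hφ : ∀ P, φ P ≠ ⊥) :
    convexConjugate (lionsLift φ) = lionsLift (mcTransform φ) := by
  funext Y
  refine le_antisymm (iSup_le fun X => ?_) (iSup_le fun P => ?_)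
  · refine le_trans ?_ (le_iSup
      (fun P => ((MC N P (adaptedLaw Y) : ℝ) : EReal) - φ P) (adaptedLaw X))
    exact EReal.sub_le_sub (EReal.coe_le_coe_iff.2 (inner_le_MC_adaptedLaw X Y)) le_rfl
  · obtain ⟨X, rfl⟩ := adaptedLaw_surjective P
    rcases EReal.eq_top_or_exists_coe (hφ (adaptedLaw X)) with h | ⟨r, h⟩
    · simp [h]
    · rw [h]
      refine EReal.coe_sub_le_of_forall_lt fun d hd => ?_
      obtain ⟨X', hX', hle⟩ := exists_rearrangement X Y hd
      refine le_trans ?_ (le_iSup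
        (fun X => ((inner ℝ X Y : ℝ) : EReal) - lionsLift φ X) X')
      rw [lionsLift, hX', h, ← EReal.coe_sub]
      exact EReal.coe_le_coe_iff.2 (by linarith)

/-- A competitor `X` for `Y` is rearranged to do almost as well against `Y'`; its `F`-value is
unchanged. -/
theorem adaptedLawInvariant_convexConjugate {F : L2 H N → EReal} (hF : ∀ X, F X ≠ ⊥)
    (hinv : AdaptedLawInvariant F) : AdaptedLawInvariant (convexConjugate F) := by
  have key : ∀ Y Y' : L2 H N, adaptedLaw Y = adaptedLaw Y' →
      convexConjugate F Y ≤ convexConjugate F Y' := by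
    intro Y Y' hY
    refine iSup_le fun X => ?_
    rcases EReal.eq_top_or_exists_coe (hF X) with h | ⟨r, h⟩
    · simp [h]
    · rw [h]
      refine EReal.coe_sub_le_of_forall_lt fun d hd => ?_
      obtain ⟨X', hX', hle⟩ := exists_rearrangement X Y'
        (hY ▸ hd.trans_le (inner_le_MC_adaptedLaw X Y))
      refine le_trans ?_ (le_iSup (fun X => ((inner ℝ X Y' : ℝ) : EReal) - F X) X')
      rw [hinv X' X hX', h, ← EReal.coe_sub]
      exact EReal.coe_le_coe_iff.2 (by linarith)
  exact fun Y Y' hY => le_antisymm (key Y Y' hY) (key Y' Y hY.symm)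

theorem isProper_lionsLift_iff {φ : P2 H N → EReal} : IsProper (lionsLift φ) ↔ IsProper φ := by
  refine and_congr ⟨fun h P => ?_, fun h X => h _⟩ ⟨fun ⟨X, hX⟩ => ⟨_, hX⟩, fun ⟨P, hP⟩ => ?_⟩
  · obtain ⟨X, rfl⟩ := adaptedLaw_surjective P
    exact h X
  · obtain ⟨X, rfl⟩ := adaptedLaw_surjective P
    exact ⟨X, hP⟩

/-- Fenchel–Moreau and two uses of the conjugate formula give `φ = (φ^MC)^MC` on adapted laws, hence
everywhere. The second use needs `φ^MC` proper, which comes from properness of the conjugate.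
Conversely, the lift of an MC-transform is a conjugate. -/
theorem isMCConvex_iff {φ : P2 H N → EReal} (hφ : IsProper φ) :
    (LowerSemicontinuous (lionsLift φ) ∧ IsConvexFun (lionsLift φ)) ↔ IsMCConvex φ := by
  constructor
  · rintro ⟨hlsc, hconv⟩
    have hF := isProper_lionsLift_iff.2 hφ
    have hstar := isProper_convexConjugate hlsc hconv hF
    have hbi := convexConjugate_convexConjugate hlsc hconv hF
    rw [convexConjugate_lionsLift hφ.1] at hstar hbi
    have hMC := isProper_lionsLift_iff.1 hstar
    rw [convexConjugate_lionsLift hMC.1] at hbi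
    refine ⟨mcTransform φ, hMC, funext fun P => ?_⟩
    obtain ⟨X, rfl⟩ := adaptedLaw_surjective P
    exact (congrFun hbi X).symm
  · rintro ⟨ψ, hψ, rfl⟩
    rw [← convexConjugate_lionsLift hψ.1]
    exact ⟨lowerSemicontinuous_convexConjugate fun X => hψ.1 _,
      isConvexFun_convexConjugate fun X => hψ.1 _⟩

end IteratedTransport

theorem theorem1p8 {H : Type u} [NormedAddCommGroup H] [InnerProductSpace ℝ H]
    [CompleteSpace H] [SecondCountableTopology H] [MeasurableSpace H] [BorelSpace H]
    (N : ℕ) (hN : 1 ≤ N) :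
    (∀ φ : P2 H N → EReal, IsProper φ →
      convexConjugate (lionsLift φ) = lionsLift (mcTransform φ) ∧
      ((LowerSemicontinuous (lionsLift φ) ∧ IsConvexFun (lionsLift φ)) ↔ IsMCConvex φ)) ∧
    (∀ F : L2 H N → EReal, (∀ X, F X ≠ ⊥) → AdaptedLawInvariant F →
      AdaptedLawInvariant (convexConjugate F)) :=
  ⟨fun _ hφ => ⟨convexConjugate_lionsLift hφ.1, isMCConvex_iff hφ⟩,
    fun _ hF hinv => adaptedLawInvariant_convexConjugate hF hinv⟩
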